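/- Let $\widetilde{\mathrm{SL}}_2(\mathbb{R})=\mathrm{SL}_2(\mathbb{R})\times\{\pm1\}$ be the metaplectic group with multiplication $(g_1,\epsilon_1)(g_2,\epsilon_2)=(g_1g_2,\alpha(g_1,g_2)\epsilon_1\epsilon_2)$, where $\alpha(g_1,g_2)=\left(\frac{X(g_1g_2)}{X(g_1)},\frac{X(g_1g_2)}{X(g_2)}\right)_H$, $(\cdot,\cdot)_H$ is the real Hilbert symbol, and $X\begin{pmatrix}a&b\\c&d\end{pmatrix}$ is $c$ if $c\neq0$ and $d$ if $c=0$; give it the smooth structure for which it is a Lie group and a smooth covering of $\mathrm{SL}_2(\mathbb{R})$. Put $\tilde m_{\epsilon_1,\epsilon_2}=(\epsilon_1 1,\epsilon_2)$, $\tilde a_u=(\mathrm{diag}(u,u^{-1}),1)$ for $u>0$, $\tilde n_x=\left(\begin{pmatrix}1&x\\0&1\end{pmatrix},1\right)$, $\tilde n_{-,x}=\left(\begin{pmatrix}1&0\\x&1\end{pmatrix},1\right)$, and $\tilde k_\theta=\left(\begin{pmatrix}\cos\theta&-\sin\theta\\\sin\theta&\cos\theta\end{pmatrix},\varepsilon(\theta)\right)$,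 where $\varepsilon$ has period $4\pi$, is $1$ on $[-\pi,\pi)$ and $-1$ on $[-2\pi,-\pi)\cup[\pi,2\pi)$; put $\tilde s=\tilde k_{\pi/2}$, $\tilde K=\{\tilde k_\theta\}$ and $\tilde B=\{\tilde m_{\epsilon_1,\epsilon_2}\tilde a_u\tilde n_{-,x}\}$. For $\epsilon\in\{\pm1\}$ and $\nu\in\mathbb{C}$ let $\omega_{\epsilon,\nu}$ be the quasi-character $\tilde m\,\tilde a_u\,\tilde n_{-,x}\mapsto\sigma_\epsilon(\tilde m)u^{\nu-1}$ of $\tilde B$, where $\sigma_\epsilon(\tilde m_{1,\pm1})=\pm1$ and $\sigma_\epsilon(\tilde m_{-1,\pm1})=\mp\epsilon i$, and let $V^\infty_{\epsilon,\nu}$ be the space of smooth $f:\widetilde{\mathrm{SL}}_2(\mathbb{R})\to\mathbb{C}$ with $f(\tilde g\tilde b)=\omega_{\epsilon,\nu}(\tilde b^{-1})f(\tilde g)$ for all $\tilde g$ and all $\tilde b\in\tilde B$. Let $I_{\epsilon,\nu}:V^\infty_{\epsilon,-\nu}\to V^\infty_{\epsilon,\nu}$ be the intertwining operator, given for $\mathrm{Re}\,\nu>0$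 by the absolutely convergent integral $$I_{\epsilon,\nu}f(\tilde g)=\int_{-\infty}^{\infty}f(\tilde g\,\tilde s\,\tilde n_t)\,dt,$$ and for other $\nu$ by meromorphic continuation in $\nu$, with $f|_{\tilde K}$ held fixed. (a) For every $\nu\in\mathbb{C}$ and every $\ell\in2\mathbb{Z}$ there is a unique $\phi_{\epsilon,\nu,\ell}\in V^\infty_{\epsilon,\nu}$ such that $\phi_{\epsilon,\nu,\ell}(\tilde k_\theta)=\exp\left(-\epsilon\left(\tfrac12+\ell\right)i\theta\right)$ for all $\theta$. (b) For every $\ell\in2\mathbb{Z}$ and every $\nu\in\mathbb{C}\setminus\mathbb{Z}_{\le0}$, $I_{\epsilon,\nu}$ is defined on $\phi_{\epsilon,-\nu,\ell}$ (the continuation has no pole at $\nu$), and $$I_{\epsilon,\nu}\phi_{\epsilon,-\nu,\ell}=i^{-\epsilon\ell}\,\frac{1-\epsilon i}{\sqrt2}\cdot\frac{\pi\,2^{1-\nu}\,\Gamma(\nu)}{\Gamma\left(-\frac12\left(\ell+\frac12\right)+\frac{\nu+1}2\right)\Gamma\left(\frac12\left(\ell+\frac12\right)+\frac{\nu+1}2\right)}\,\phi_{\epsilon,\nu,\ell},$$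 where $1/\Gamma$ is read as $0$ at the poles of $\Gamma$. (c) For every $\nu\in\mathbb{C}\setminus\mathbb{Z}$ and every $f\in V^\infty_{\epsilon,-\nu}$, $I_{\epsilon,\nu}$ is defined on $f$, $I_{\epsilon,\nu}f\in V^\infty_{\epsilon,\nu}$, $I_{\epsilon,-\nu}$ is defined on $I_{\epsilon,\nu}f$, and $$I_{\epsilon,-\nu}I_{\epsilon,\nu}f=\frac{2\pi\epsilon i\cot(\pi\nu)}{\nu}\,f.$$ -/

import Mathlib

open MeasureTheory Set
open scoped MatrixGroups ContDiff Manifold UpperHalfPlane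

noncomputable section

namespace Metaplectic

/-- The Hilbert symbol of `ℝ`. -/
def hilbertSymbol (x y : ℝ) : ℤˣ := if x < 0 ∧ y < 0 then -1 else 1

/-- `X (a b; c d)` is `c` if `c ≠ 0` and `d` if `c = 0`. -/
def kubotaX (g : SL(2, ℝ)) : ℝ := if g 1 0 ≠ 0 then g 1 0 else g 1 1

/-- The Kubota cocycle `α`. -/
def cocycle (g₁ g₂ : SL(2, ℝ)) : ℤˣ :=
  hilbertSymbol (kubotaX (g₁ * g₂) / kubotaX g₁) (kubotaX (g₁ * g₂) / kubotaX g₂)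

/-! ### The cocycle identity

It is proved with the arguments of the automorphy factors `c z + d`. -/

/-- The argument of a complex number, normalised to lie in `[-π, π)`. -/
def argL (w : ℂ) : ℝ := if Complex.arg w = Real.pi then -Real.pi else Complex.arg w

theorem argL_mem (w : ℂ) : -Real.pi ≤ argL w ∧ argL w < Real.pi := by
  unfold argL
  have h1 := Complex.neg_pi_lt_arg w
  have h2 := Complex.arg_le_pi w
  have h3 := Real.pi_pos
  split_ifs with h
  · constructor <;> linarith
  · exact ⟨h1.le, lt_of_le_of_ne h2 h⟩

theorem argL_coe (w : ℂ) : (argL w : Real.Angle) = (Complex.arg w : Real.Angle) := by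
  unfold argL
  split_ifs with h
  · rw [h]; simp
  · rfl

theorem kubotaX_ne_zero (g : SL(2, ℝ)) : kubotaX g ≠ 0 := by
  unfold kubotaX
  split_ifs with h
  · exact h
  · intro h'
    have := g.det_coe
    rw [Matrix.det_fin_two] at this
    push Not at h
    simp_all

/-- The automorphy factor `c z + d`. -/
def autFactor (g : SL(2, ℝ)) (z : ℍ) : ℂ := (g 1 0 : ℂ) * z + (g 1 1 : ℂ)

theorem argL_autFactor (g : SL(2, ℝ)) (z : ℍ) :
    (0 < kubotaX g ↔ 0 ≤ argL (autFactor g z)) := by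
  have hX := kubotaX_ne_zero g
  have hz := z.im_pos
  have hpi := Real.pi_pos
  have him : (autFactor g z).im = g 1 0 * z.im := by simp [autFactor]
  have hre : g 1 0 = 0 → autFactor g z = ((g 1 1 : ℝ) : ℂ) := by
    intro h; simp [autFactor, h]
  by_cases hc : g 1 0 = 0
  · have hk : kubotaX g = g 1 1 := by simp [kubotaX, hc]
    rw [hk] at hX ⊢
    rw [hre hc]
    rcases lt_or_gt_of_ne hX with h | h
    · have : Complex.arg ((g 1 1 : ℝ) : ℂ) = Real.pi := Complex.arg_ofReal_of_neg h
      simp only [argL, this, if_true]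
      constructor <;> intro <;> linarith
    · have : Complex.arg ((g 1 1 : ℝ) : ℂ) = 0 := Complex.arg_ofReal_of_nonneg h.le
      simp only [argL, this, if_neg hpi.ne]
      exact ⟨fun _ => le_refl _, fun _ => h⟩
  · have hk : kubotaX g = g 1 0 := by simp [kubotaX, hc]
    rw [hk]
    have hne : Complex.arg (autFactor g z) ≠ Real.pi := by
      intro h
      have := (Complex.arg_eq_pi_iff.1 h).2
      rw [him] at this
      rcases mul_eq_zero.1 this with h | h
      · exact hc h
      · exact hz.ne' h
    simp only [argL, if_neg hne]
    rw [Complex.arg_nonneg_iff, him]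
    constructor
    · intro h; positivity
    · intro h
      rcases lt_or_gt_of_ne hc with h' | h'
      · nlinarith
      · exact h'

theorem autFactor_ne_zero (g : SL(2, ℝ)) (z : ℍ) : autFactor g z ≠ 0 := by
  have := UpperHalfPlane.denom_ne_zero (g : GL (Fin 2) ℝ) z
  simpa [UpperHalfPlane.denom, autFactor] using this

theorem autFactor_mul (g h : SL(2, ℝ)) (z : ℍ) :
    autFactor (g * h) z = autFactor g (h • z) * autFactor h z := by
  have h0 := autFactor_ne_zero h z
  have h1 : ((h • z : ℍ) : ℂ) = ((h 0 0 : ℂ) * z + (h 0 1 : ℂ)) / autFactor h z := by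
    rw [UpperHalfPlane.specialLinearGroup_apply]; simp [autFactor]
  have h2 : autFactor g (h • z) = (g 1 0 : ℂ) * ((h • z : ℍ) : ℂ) + (g 1 1 : ℂ) := rfl
  rw [h2, h1, add_mul, mul_assoc, div_mul_cancel₀ _ h0]
  simp only [autFactor, Matrix.SpecialLinearGroup.coe_mul, Matrix.mul_apply, Fin.sum_univ_two]
  push_cast
  ring

/-- The integer-valued refinement of the cocycle. -/
def cocycleZ (g₁ g₂ : SL(2, ℝ)) : ℤ :=
  if 0 < kubotaX g₁ ∧ 0 < kubotaX g₂ ∧ kubotaX (g₁ * g₂) < 0 then 1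
  else if kubotaX g₁ < 0 ∧ kubotaX g₂ < 0 ∧ 0 < kubotaX (g₁ * g₂) then -1 else 0

theorem argL_mul (g h : SL(2, ℝ)) (z : ℍ) :
    argL (autFactor g (h • z)) + argL (autFactor h z) =
      argL (autFactor (g * h) z) + 2 * Real.pi * cocycleZ g h := by
  have e : ((argL (autFactor g (h • z)) + argL (autFactor h z) : ℝ) : Real.Angle) =
      (argL (autFactor (g * h) z) : Real.Angle) := by
    rw [Real.Angle.coe_add, argL_coe, argL_coe, argL_coe, autFactor_mul,
      Complex.arg_mul_coe_angle (autFactor_ne_zero _ _) (autFactor_ne_zero _ _)]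
  obtain ⟨k, hk⟩ := Real.Angle.angle_eq_iff_two_pi_dvd_sub.1 e
  have a1 := argL_mem (autFactor g (h • z))
  have a2 := argL_mem (autFactor h z)
  have a3 := argL_mem (autFactor (g * h) z)
  have s1 := argL_autFactor g (h • z)
  have s2 := argL_autFactor h z
  have s3 := argL_autFactor (g * h) z
  have n1 := kubotaX_ne_zero g
  have n2 := kubotaX_ne_zero h
  have n3 := kubotaX_ne_zero (g * h)
  have hpi := Real.pi_pos
  have key : k = cocycleZ g h := by
    have kb1 : k < 2 := by
      by_contra hc
      have : (2 : ℝ) ≤ k := by exact_mod_cast not_lt.1 hc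
      nlinarith
    have kb2 : -2 < k := by
      by_contra hc
      have : (k : ℝ) ≤ -2 := by exact_mod_cast not_lt.1 hc
      nlinarith
    unfold cocycleZ
    rcases lt_or_gt_of_ne n1 with m1 | m1 <;> rcases lt_or_gt_of_ne n2 with m2 | m2 <;>
      rcases lt_or_gt_of_ne n3 with m3 | m3 <;>
      simp only [m1, m2, m3, m1.not_gt, m2.not_gt, m3.not_gt, and_false,
        and_true, if_true, if_false, true_iff, false_iff, not_le] at s1 s2 s3 ⊢ <;>
      interval_cases k <;> first | rfl | (exfalso; push_cast at hk; linarith)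
  rw [← key]; linarith

theorem cocycle_eq (g₁ g₂ : SL(2, ℝ)) : cocycle g₁ g₂ = (-1) ^ (cocycleZ g₁ g₂) := by
  have n1 := kubotaX_ne_zero g₁
  have n2 := kubotaX_ne_zero g₂
  have n3 := kubotaX_ne_zero (g₁ * g₂)
  unfold cocycle hilbertSymbol cocycleZ
  simp only [div_neg_iff]
  rcases lt_or_gt_of_ne n1 with m1 | m1 <;> rcases lt_or_gt_of_ne n2 with m2 | m2 <;>
    rcases lt_or_gt_of_ne n3 with m3 | m3 <;>
    simp [m1, m2, m3, m1.not_gt, m2.not_gt, m3.not_gt]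

theorem cocycle_assoc (g₁ g₂ g₃ : SL(2, ℝ)) :
    cocycle g₁ g₂ * cocycle (g₁ * g₂) g₃ = cocycle g₁ (g₂ * g₃) * cocycle g₂ g₃ := by
  have e1 := argL_mul g₁ g₂ (g₃ • UpperHalfPlane.I)
  have e2 := argL_mul (g₁ * g₂) g₃ UpperHalfPlane.I
  have e3 := argL_mul g₁ (g₂ * g₃) UpperHalfPlane.I
  have e4 := argL_mul g₂ g₃ UpperHalfPlane.I
  rw [mul_smul] at e3
  rw [mul_assoc] at e2
  have e : (2 * Real.pi) * ((cocycleZ g₁ g₂ + cocycleZ (g₁ * g₂) g₃ : ℤ) : ℝ) =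
      (2 * Real.pi) * ((cocycleZ g₁ (g₂ * g₃) + cocycleZ g₂ g₃ : ℤ) : ℝ) := by
    push_cast; linarith
  have e' := mul_left_cancel₀ (by positivity) e
  simp only [cocycle_eq, ← zpow_add]
  congr 1
  exact_mod_cast e'

/-! ### The metaplectic group -/

/-- The underlying set `SL₂(ℝ) × {±1}` of the metaplectic group. -/
@[ext]
structure Mp where
  mat : SL(2, ℝ)
  sgn : ℤˣ

namespace Mp

instance : Mul Mp := ⟨fun x y => ⟨x.mat * y.mat, cocycle x.mat y.mat * x.sgn * y.sgn⟩⟩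
instance : One Mp := ⟨⟨1, 1⟩⟩
instance : Inv Mp := ⟨fun x => ⟨x.mat⁻¹, cocycle x.mat⁻¹ x.mat * x.sgn⟩⟩

@[simp] theorem mul_mat (x y : Mp) : (x * y).mat = x.mat * y.mat := rfl
@[simp] theorem mul_sgn (x y : Mp) : (x * y).sgn = cocycle x.mat y.mat * x.sgn * y.sgn := rfl
@[simp] theorem one_mat : (1 : Mp).mat = 1 := rfl
@[simp] theorem one_sgn : (1 : Mp).sgn = 1 := rfl
@[simp] theorem inv_mat (x : Mp) : (x⁻¹).mat = x.mat⁻¹ := rfl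
@[simp] theorem inv_sgn (x : Mp) : (x⁻¹).sgn = cocycle x.mat⁻¹ x.mat * x.sgn := rfl

theorem cocycle_one_left (g : SL(2, ℝ)) : cocycle 1 g = 1 := by
  have h := kubotaX_ne_zero g
  simp only [cocycle, hilbertSymbol, one_mul, div_self h]
  rw [if_neg]
  rintro ⟨-, h⟩
  linarith

instance : Group Mp := Group.ofLeftAxioms
  (fun x y z => by
    ext1
    · simp [mul_assoc]
    · have h := cocycle_assoc x.mat y.mat z.mat
      simp only [mul_sgn, mul_mat]
      calc cocycle (x.mat * y.mat) z.mat * (cocycle x.mat y.mat * x.sgn * y.sgn) * z.sgn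
          = (cocycle x.mat y.mat * cocycle (x.mat * y.mat) z.mat) *
              (x.sgn * y.sgn * z.sgn) := by
            simp only [mul_assoc, mul_left_comm, mul_comm]
        _ = _ := by rw [h]; simp only [mul_assoc, mul_left_comm, mul_comm])
  (fun x => by ext1 <;> simp [cocycle_one_left])
  (fun x => by
    ext1
    · simp
    · simp only [mul_sgn, inv_mat, inv_sgn, one_sgn]
      rw [← mul_assoc, Int.units_mul_self, one_mul, Int.units_mul_self])

end Mp

/-! ### The elements `m̃`, `ã`, `ñ`, `ñ₋`, `k̃`, `s̃` -/

def mTilde (ε₁ ε₂ : ℤˣ) : Mp :=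
  ⟨⟨!![((ε₁ : ℤ) : ℝ), 0; 0, ((ε₁ : ℤ) : ℝ)], by
    rcases Int.units_eq_one_or ε₁ with h | h <;> simp [h, Matrix.det_fin_two]⟩, ε₂⟩

def aTilde (u : ℝ) (hu : 0 < u) : Mp :=
  ⟨⟨!![u, 0; 0, u⁻¹], by simp [Matrix.det_fin_two, hu.ne']⟩, 1⟩

def nTilde (x : ℝ) : Mp := ⟨⟨!![1, x; 0, 1], by simp [Matrix.det_fin_two]⟩, 1⟩

def nMinusTilde (x : ℝ) : Mp := ⟨⟨!![1, 0; x, 1], by simp [Matrix.det_fin_two]⟩, 1⟩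

theorem four_pi_pos : 0 < 4 * Real.pi := by positivity

/-- The sign `ε(θ)`: equal to `1` on `[-π, π)`, to `-1` on the rest of `[-2π, 2π)`, and extended
to `ℝ` with period `4π`. -/
def kSign (θ : ℝ) : ℤˣ :=
  if toIcoMod four_pi_pos (-(2 * Real.pi)) θ ∈ Ico (-Real.pi) Real.pi then 1 else -1

def kTilde (θ : ℝ) : Mp :=
  ⟨⟨!![Real.cos θ, -Real.sin θ; Real.sin θ, Real.cos θ], by
    rw [Matrix.det_fin_two_of]; nlinarith [Real.sin_sq_add_cos_sq θ]⟩, kSign θ⟩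

def sTilde : Mp := kTilde (Real.pi / 2)

/-! ### The smooth structure

The map `(θ, u, x) ↦ k̃_θ ã_u ñ₋_x` from `(ℝ / 4πℤ) × ℝ_{>0} × ℝ` onto the group (Iwasawa
decomposition) is a diffeomorphism.  With the polar coordinates `w = u e^{iθ/2}` on the punctured
plane, this says that `(w, x) ↦ k̃_{2 arg w} ã_{|w|} ñ₋_x` is a diffeomorphism from
`(ℂ ∖ {0}) × ℝ` onto the group; its inverse is used as a global chart. -/

theorem kSign_add_two_pi (θ : ℝ) : kSign (θ + 2 * Real.pi) = -kSign θ := by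
  have hpi := Real.pi_pos
  obtain ⟨h1, z, hz⟩ := (toIcoMod_eq_iff four_pi_pos (a := -(2 * Real.pi)) (b := θ)).1 rfl
  set t := toIcoMod four_pi_pos (-(2 * Real.pi)) θ with ht
  have h1l := h1.1
  have h1r := h1.2
  by_cases h : t < 0
  · have e : toIcoMod four_pi_pos (-(2 * Real.pi)) (θ + 2 * Real.pi) = t + 2 * Real.pi := by
      rw [toIcoMod_eq_iff]
      refine ⟨⟨by linarith, by linarith⟩, z, by linarith⟩
    unfold kSign
    rw [e, ← ht]
    by_cases h' : -Real.pi ≤ t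
    · rw [if_neg (by rintro ⟨_, _⟩; linarith), if_pos ⟨h', by linarith⟩]
    · rw [if_pos ⟨by linarith, by linarith⟩, if_neg (fun hh => h' hh.1), neg_neg]
  · have e : toIcoMod four_pi_pos (-(2 * Real.pi)) (θ + 2 * Real.pi) = t - 2 * Real.pi := by
      rw [toIcoMod_eq_iff]
      refine ⟨⟨by linarith, by linarith⟩, z + 1, by rw [add_smul, one_smul]; linarith⟩
    unfold kSign
    rw [e, ← ht]
    by_cases h' : t < Real.pi
    · rw [if_neg (by rintro ⟨_, _⟩; linarith), if_pos ⟨by linarith, h'⟩]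
    · rw [if_pos ⟨by linarith, by linarith⟩, if_neg (fun hh => h' hh.2), neg_neg]

theorem kSign_add_int_mul (θ : ℝ) (n : ℤ) :
    kSign (θ + n * (2 * Real.pi)) = (-1) ^ n * kSign θ := by
  induction n using Int.induction_on with
  | zero => simp
  | succ n ih =>
    have : θ + ((n + 1 : ℤ) : ℝ) * (2 * Real.pi) = θ + ((n : ℤ) : ℝ) * (2 * Real.pi) +
        2 * Real.pi := by push_cast; ring
    rw [this, kSign_add_two_pi, ih, zpow_add_one]; simp
  | pred n ih =>
    have h := kSign_add_two_pi (θ + ((-n - 1 : ℤ) : ℝ) * (2 * Real.pi))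
    have : θ + ((-n - 1 : ℤ) : ℝ) * (2 * Real.pi) + 2 * Real.pi =
        θ + ((-n : ℤ) : ℝ) * (2 * Real.pi) := by push_cast; ring
    rw [this, ih] at h
    rw [zpow_sub_one, ← neg_inj, ← h]
    simp

theorem kTilde_add_four_pi_mul (θ : ℝ) (n : ℤ) :
    kTilde (θ + n * (4 * Real.pi)) = kTilde θ := by
  have e : θ + n * (4 * Real.pi) = θ + ((2 * n : ℤ) : ℝ) * (2 * Real.pi) := by push_cast; ring
  ext1
  · ext i j
    rw [e]
    fin_cases i <;> fin_cases j <;>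
      simp [kTilde, -Int.cast_mul, Real.cos_add_int_mul_two_pi, Real.sin_add_int_mul_two_pi]
  · change kSign _ = kSign _
    rw [e, kSign_add_int_mul, zpow_mul]
    simp

/-- The Iwasawa parametrisation `(w, x) ↦ k̃_{2 arg w} ã_{|w|} ñ₋_x`. -/
def iwasawa (p : {w : ℂ // w ≠ 0} × ℝ) : Mp :=
  kTilde (2 * Complex.arg p.1) * aTilde ‖(p.1 : ℂ)‖ (norm_pos_iff.2 p.1.2) * nMinusTilde p.2

theorem kan_mat (θ u x : ℝ) (hu : 0 < u) :
    ((kTilde θ * aTilde u hu * nMinusTilde x).mat : Matrix (Fin 2) (Fin 2) ℝ) =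
      !![Real.cos θ * u - Real.sin θ * u⁻¹ * x, -(Real.sin θ * u⁻¹);
         Real.sin θ * u + Real.cos θ * u⁻¹ * x, Real.cos θ * u⁻¹] := by
  rw [Mp.mul_mat, Mp.mul_mat, Matrix.SpecialLinearGroup.coe_mul, Matrix.SpecialLinearGroup.coe_mul]
  change (!![Real.cos θ, -Real.sin θ; Real.sin θ, Real.cos θ] * !![u, 0; 0, u⁻¹]) *
    !![1, 0; x, 1] = _
  simp [sub_eq_add_neg]

theorem iwasawa_polar (θ u x : ℝ) (hu : 0 < u) :
    iwasawa (⟨u * Complex.exp ((θ / 2 : ℝ) * Complex.I), by simp [hu.ne']⟩, x) =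
      kTilde θ * aTilde u hu * nMinusTilde x := by
  have h1 : ‖(u : ℂ) * Complex.exp ((θ / 2 : ℝ) * Complex.I)‖ = u := by
    rw [norm_mul, Complex.norm_exp_ofReal_mul_I, mul_one, Complex.norm_real, Real.norm_eq_abs,
      abs_of_pos hu]
  have h2 : kTilde (2 * Complex.arg ((u : ℂ) * Complex.exp ((θ / 2 : ℝ) * Complex.I))) =
      kTilde θ := by
    rw [Complex.arg_real_mul _ hu, Complex.arg_exp_mul_I, toIocMod]
    have := kTilde_add_four_pi_mul θ (-toIocDiv Real.two_pi_pos (-Real.pi) (θ / 2))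
    rw [← this]
    congr 1
    simp only [zsmul_eq_mul]
    push_cast
    ring
  have h3 : ∀ (u' : ℝ) (hu' : 0 < u'), u' = u → aTilde u' hu' = aTilde u hu := by
    intro u' hu' e; subst e; rfl
  unfold iwasawa
  dsimp only
  rw [h2, h3 _ _ h1]

theorem iwasawa_injective : Function.Injective iwasawa := by
  rintro ⟨⟨w, hw⟩, x⟩ ⟨⟨w', hw'⟩, x'⟩ h
  have hm := congrArg (fun g : Mp => (g.mat : Matrix (Fin 2) (Fin 2) ℝ)) h
  simp only [iwasawa, kan_mat] at hm
  have hu := norm_pos_iff.2 hw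
  have hu' := norm_pos_iff.2 hw'
  have e00 := congrFun (congrFun hm 0) 0
  have e01 := congrFun (congrFun hm 0) 1
  have e10 := congrFun (congrFun hm 1) 0
  have e11 := congrFun (congrFun hm 1) 1
  simp only [Matrix.of_apply, Matrix.cons_val', Matrix.cons_val_zero, Matrix.cons_val_one,
    Matrix.cons_val_fin_one, neg_inj] at e00 e01 e10 e11
  have t := Real.sin_sq_add_cos_sq (2 * Complex.arg w)
  have t' := Real.sin_sq_add_cos_sq (2 * Complex.arg w')
  have huu : ‖w‖⁻¹ = ‖w'‖⁻¹ := by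
    have : (‖w‖⁻¹) ^ 2 = (‖w'‖⁻¹) ^ 2 := by
      calc (‖w‖⁻¹) ^ 2 = (Real.sin (2 * Complex.arg w) * ‖w‖⁻¹) ^ 2 +
            (Real.cos (2 * Complex.arg w) * ‖w‖⁻¹) ^ 2 := by
            linear_combination -(‖w‖⁻¹) ^ 2 * t
        _ = _ := by rw [e01, e11]; linear_combination (‖w'‖⁻¹) ^ 2 * t'
    exact (pow_left_inj₀ (by positivity) (by positivity) two_ne_zero).1 this
  have hn : ‖w‖ = ‖w'‖ := inv_injective huu
  rw [huu] at e01 e11 e00 e10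
  rw [hn] at e00 e10
  have hi : ‖w'‖⁻¹ ≠ 0 := by positivity
  have es := mul_right_cancel₀ hi e01
  have ec := mul_right_cancel₀ hi e11
  rw [es, ec] at e00 e10
  have hx : x = x' := by
    have : ‖w'‖⁻¹ * x = ‖w'‖⁻¹ * x' := by
      linear_combination (-Real.sin (2 * Complex.arg w')) * e00 +
        Real.cos (2 * Complex.arg w') * e10 - ‖w'‖⁻¹ * (x - x') * t'
    exact mul_left_cancel₀ hi this
  subst hx
  have h3 : ∀ (u v : ℝ) (hu : 0 < u) (hv : 0 < v), u = v → aTilde u hu = aTilde v hv := by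
    intro u v hu hv e; subst e; rfl
  have hk : kTilde (2 * Complex.arg w) = kTilde (2 * Complex.arg w') := by
    unfold iwasawa at h
    dsimp only at h
    rw [h3 _ _ hu hu' hn] at h
    exact mul_right_cancel (mul_right_cancel h)
  have hsgn : kSign (2 * Complex.arg w) = kSign (2 * Complex.arg w') := congrArg Mp.sgn hk
  obtain ⟨n, hn2⟩ := Real.Angle.angle_eq_iff_two_pi_dvd_sub.1
    (Real.Angle.cos_sin_inj ec es)
  have hθ : 2 * Complex.arg w = 2 * Complex.arg w' + n * (2 * Real.pi) := by linarith
  rw [hθ, kSign_add_int_mul] at hsgn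
  have hpar : ((-1 : ℤˣ)) ^ n = 1 := mul_eq_right.1 hsgn
  have hev : Even n := by
    rcases Int.even_or_odd n with he | ho
    · exact he
    · rw [ho.neg_one_zpow] at hpar
      exact absurd hpar (by decide)
  obtain ⟨m, rfl⟩ := hev
  have hpi := Real.pi_pos
  have b1 := Complex.neg_pi_lt_arg w
  have b2 := Complex.arg_le_pi w
  have b3 := Complex.neg_pi_lt_arg w'
  have b4 := Complex.arg_le_pi w'
  push_cast at hθ
  have hm0 : m = 0 := by
    have m1 : m < 1 := by
      by_contra hc
      have : (1 : ℝ) ≤ m := by exact_mod_cast not_lt.1 hc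
      nlinarith
    have m2 : -1 < m := by
      by_contra hc
      have : (m : ℝ) ≤ -1 := by exact_mod_cast not_lt.1 hc
      nlinarith
    omega
  subst hm0
  have harg : Complex.arg w = Complex.arg w' := by
    push_cast at hθ; linarith
  have : w = w' := Complex.ext_norm_arg hn harg
  subst this
  rfl

/-- The `A`-coordinate `u` in the Iwasawa decomposition `g̃ = k̃_θ ã_u ñ₋_x`; the second column of
`k̃_θ ã_u ñ₋_x` is `u⁻¹ (-sin θ, cos θ)`. -/
def iwasawaA (g : Mp) : ℝ := (Real.sqrt ((g.mat 0 1) ^ 2 + (g.mat 1 1) ^ 2))⁻¹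

theorem iwasawaA_kan (θ u x : ℝ) (hu : 0 < u) :
    iwasawaA (kTilde θ * aTilde u hu * nMinusTilde x) = u := by
  have h := kan_mat θ u x hu
  have e01 := congrFun (congrFun h 0) 1
  have e11 := congrFun (congrFun h 1) 1
  simp only [Matrix.of_apply, Matrix.cons_val', Matrix.cons_val_zero, Matrix.cons_val_one,
    Matrix.cons_val_fin_one] at e01 e11
  have : (-(Real.sin θ * u⁻¹)) ^ 2 + (Real.cos θ * u⁻¹) ^ 2 = (u⁻¹) ^ 2 := by
    linear_combination (u⁻¹) ^ 2 * Real.sin_sq_add_cos_sq θ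
  unfold iwasawaA
  rw [e01, e11, this, Real.sqrt_sq (by positivity), inv_inv]

theorem iwasawa_surjective : Function.Surjective iwasawa := by
  intro g
  set a := g.mat 0 0 with ha
  set b := g.mat 0 1 with hb
  set c := g.mat 1 0 with hc
  set d := g.mat 1 1 with hd
  have hdet : a * d - b * c = 1 := by
    have := g.mat.det_coe
    rwa [Matrix.det_fin_two] at this
  have hz : (⟨d, -b⟩ : ℂ) ≠ 0 := by
    intro h
    have h1 := congrArg Complex.re h
    have h2 := congrArg Complex.im h
    simp only [Complex.zero_re, Complex.zero_im, neg_eq_zero] at h1 h2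
    rw [h1, h2] at hdet
    norm_num at hdet
  set r := ‖(⟨d, -b⟩ : ℂ)‖ with hr
  have hrpos : 0 < r := norm_pos_iff.2 hz
  have hr2 : r ^ 2 = b ^ 2 + d ^ 2 := by
    rw [hr, ← Complex.normSq_eq_norm_sq, Complex.normSq_apply]; ring
  set θ := Complex.arg ⟨d, -b⟩ with hθ
  have hcos : r * Real.cos θ = d := Complex.norm_mul_cos_arg _
  have hsin : r * Real.sin θ = -b := Complex.norm_mul_sin_arg _
  have mat_eq : ∀ n : ℤ, (kTilde (θ + n * (2 * Real.pi)) * aTilde r⁻¹ (inv_pos.2 hrpos) *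
      nMinusTilde ((a * b + c * d) / r ^ 2)).mat = g.mat := by
    intro n
    apply Subtype.ext
    rw [kan_mat, Real.cos_add_int_mul_two_pi, Real.sin_add_int_mul_two_pi]
    have hc' : Real.cos θ = d / r := by rw [← hcos]; field_simp
    have hs' : Real.sin θ = -b / r := by rw [← hsin]; field_simp
    rw [hc', hs', inv_inv]
    ext i j
    fin_cases i <;> fin_cases j
    · change d / r * r⁻¹ - -b / r * r * ((a * b + c * d) / r ^ 2) = a
      field_simp
      rw [hr2]
      linear_combination (-d) * hdet
    · change -(-b / r * r) = b
      field_simp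
    · change -b / r * r⁻¹ + d / r * r * ((a * b + c * d) / r ^ 2) = c
      field_simp
      rw [hr2]
      linear_combination b * hdet
    · change d / r * r = d
      field_simp
  have main : ∃ n : ℤ, kTilde (θ + n * (2 * Real.pi)) * aTilde r⁻¹ (inv_pos.2 hrpos) *
      nMinusTilde ((a * b + c * d) / r ^ 2) = g := by
    by_cases h : (kTilde (θ + (0 : ℤ) * (2 * Real.pi)) * aTilde r⁻¹ (inv_pos.2 hrpos) *
      nMinusTilde ((a * b + c * d) / r ^ 2)).sgn = g.sgn
    · exact ⟨0, Mp.ext (mat_eq 0) h⟩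
    · refine ⟨1, Mp.ext (mat_eq 1) ?_⟩
      have hk : (kTilde (θ + (1 : ℤ) * (2 * Real.pi))).mat =
          (kTilde (θ + (0 : ℤ) * (2 * Real.pi))).mat := by
        apply Subtype.ext
        simp [kTilde]
      have hs : (kTilde (θ + (1 : ℤ) * (2 * Real.pi))).sgn =
          -(kTilde (θ + (0 : ℤ) * (2 * Real.pi))).sgn := by
        change kSign _ = -kSign _
        rw [kSign_add_int_mul, kSign_add_int_mul]; simp
      simp only [Mp.mul_sgn, Mp.mul_mat, hk, hs] at h ⊢
      rw [mul_neg, neg_mul, mul_neg, neg_mul]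
      exact (Int.units_ne_iff_eq_neg.1 (Ne.symm h)).symm
  obtain ⟨n, hn⟩ := main
  exact ⟨_, (iwasawa_polar _ _ _ _).trans hn⟩

def iwasawaEquiv : {w : ℂ // w ≠ 0} × ℝ ≃ Mp :=
  Equiv.ofBijective iwasawa ⟨iwasawa_injective, iwasawa_surjective⟩

instance : TopologicalSpace Mp := TopologicalSpace.coinduced iwasawaEquiv inferInstance

def iwasawaHomeomorph : {w : ℂ // w ≠ 0} × ℝ ≃ₜ Mp :=
  iwasawaEquiv.toHomeomorph (fun _ => isOpen_coinduced.symm)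

/-- The global chart `k̃_θ ã_u ñ₋_x ↦ (u e^{iθ/2}, x)`. -/
def iwasawaChart (g : Mp) : ℂ × ℝ :=
  (((iwasawaHomeomorph.symm g).1 : ℂ), (iwasawaHomeomorph.symm g).2)

theorem iwasawaChart_isOpenEmbedding : Topology.IsOpenEmbedding iwasawaChart := by
  have h1 : Topology.IsOpenEmbedding (Prod.map (Subtype.val : {w : ℂ // w ≠ 0} → ℂ) (id : ℝ → ℝ)) :=
    (isOpen_ne.isOpenEmbedding_subtypeVal).prodMap Topology.IsOpenEmbedding.id
  exact h1.comp iwasawaHomeomorph.symm.isOpenEmbedding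

instance : ChartedSpace (ℂ × ℝ) Mp := iwasawaChart_isOpenEmbedding.singletonChartedSpace

instance : IsManifold 𝓘(ℝ, ℂ × ℝ) ∞ Mp :=
  iwasawaChart_isOpenEmbedding.isManifold_singleton

/-! ### Principal series -/

/-- `σ_ε` on `m̃_{ε₁,ε₂}`: `σ_ε(1, ±1) = ±1` and `σ_ε(-1, ±1) = ∓ ε i`. -/
def sigmaChar (ε ε₁ ε₂ : ℤˣ) : ℂ :=
  if ε₁ = 1 then ((ε₂ : ℤ) : ℂ) else -((ε₂ : ℤ) : ℂ) * ((ε : ℤ) : ℂ) * Complex.I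

/-- `ω_{ε,ν}(m̃ ã_u ñ₋) = σ_ε(m̃) u^{ν-1}`, as a function of the parameters of `m̃` and `ã_u`. -/
def omegaChar (ε : ℤˣ) (ν : ℂ) (ε₁ ε₂ : ℤˣ) (u : ℝ) : ℂ := sigmaChar ε ε₁ ε₂ * (u : ℂ) ^ (ν - 1)

/-- The smooth principal series space `V_{ε,ν}^∞`: smooth functions on the metaplectic group with
`f(g̃ b̃) = ω_{ε,ν}(b̃⁻¹) f(g̃)` for all `b̃ ∈ B̃`, where `b̃⁻¹ = m̃ ã ñ₋` runs through
`B̃ = M̃ Ã Ñ₋`. -/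
def principalSeries (ε : ℤˣ) (ν : ℂ) : Submodule ℂ (Mp → ℂ) where
  carrier := {f | ContMDiff 𝓘(ℝ, ℂ × ℝ) 𝓘(ℝ, ℂ) ∞ f ∧
    ∀ (g b : Mp) (ε₁ ε₂ : ℤˣ) (u : ℝ) (hu : 0 < u) (x : ℝ),
      b⁻¹ = mTilde ε₁ ε₂ * aTilde u hu * nMinusTilde x →
        f (g * b) = omegaChar ε ν ε₁ ε₂ u * f g}
  zero_mem' := ⟨contMDiff_const, by intros; simp⟩
  add_mem' := by
    rintro f₁ f₂ ⟨h1, h1'⟩ ⟨h2, h2'⟩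
    refine ⟨h1.add h2, ?_⟩
    intro g b ε₁ ε₂ u hu x hb
    simp only [Pi.add_apply, h1' g b ε₁ ε₂ u hu x hb, h2' g b ε₁ ε₂ u hu x hb, mul_add]
  smul_mem' := by
    rintro c f ⟨h1, h1'⟩
    refine ⟨((contDiff_const (c := c)).mul contDiff_id).contMDiff.comp h1, ?_⟩
    intro g b ε₁ ε₂ u hu x hb
    simp only [Pi.smul_apply, h1' g b ε₁ ε₂ u hu x hb, smul_eq_mul, mul_left_comm]

/-! ### The intertwining operators -/

/-- For `f ∈ V_{ε,-ν}^∞`, the element of `V_{ε,-μ}^∞` with the same restriction to `K̃` as `f`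
(the identification of the compact picture): elements `f` of `V_{ε,-μ}^∞` satisfy
`f(k̃ ã_u ñ₋) = u^{μ+1} f(k̃)`. -/
def transport (ν μ : ℂ) (f : Mp → ℂ) (g : Mp) : ℂ := f g * (iwasawaA g : ℂ) ^ (μ - ν)

/-- `F` is the meromorphic continuation to `ℂ`, in the parameter `μ`, of the absolutely convergent
integral `∫ f_μ(g̃ s̃ ñ_t) dt`, `Re μ > 0`, where `f_μ ∈ V_{ε,-μ}^∞` has the same restriction to `K̃`
as `f ∈ V_{ε,-ν}^∞`.  The normal form only fixes the values of `F` at points of a discrete set: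
removable singularities are removed. -/
def IsIntertwiningContinuation (ν : ℂ) (f : Mp → ℂ) (g : Mp) (F : ℂ → ℂ) : Prop :=
  MeromorphicNFOn F univ ∧
    ∀ μ : ℂ, 0 < μ.re →
      Integrable (fun t : ℝ => transport ν μ f (g * sTilde * nTilde t)) ∧
        F μ = ∫ t : ℝ, transport ν μ f (g * sTilde * nTilde t)

/-- The operator `I_{ε,ν}` is defined on `f ∈ V_{ε,-ν}^∞`: at every point of the group the
meromorphic continuation of the integral exists and has no pole at `ν`. -/
def IntertwiningDefinedAt (ν : ℂ) (f : Mp → ℂ) : Prop :=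
  ∀ g : Mp, ∃ F : ℂ → ℂ, IsIntertwiningContinuation ν f g F ∧ AnalyticAt ℂ F ν

open Classical in
/-- The intertwining operator `I_{ε,ν}` on `V_{ε,-ν}^∞`: the value at `ν` of the meromorphic
continuation of the integral, so `∫ f(g̃ s̃ ñ_t) dt` if `Re ν > 0`.  The formula does not
involve `ε`. -/
def intertwining (ν : ℂ) (f : Mp → ℂ) (g : Mp) : ℂ :=
  if h : ∃ F : ℂ → ℂ, IsIntertwiningContinuation ν f g F then h.choose ν else 0

/-- `φ` is a vector `φ_{ε,ν,ℓ}` of `V_{ε,ν}^∞`: on `K̃` it is the character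
`k̃_θ ↦ exp(-ε (1/2 + ℓ) i θ)`. -/
def IsKVector (ε : ℤˣ) (ν : ℂ) (ℓ : ℤ) (φ : Mp → ℂ) : Prop :=
  φ ∈ principalSeries ε ν ∧
    ∀ θ : ℝ, φ (kTilde θ) = Complex.exp (-((ε : ℤ) : ℂ) * (1 / 2 + (ℓ : ℂ)) * Complex.I * (θ : ℂ))

end Metaplectic

end

noncomputable section

namespace Metaplectic

/-! ### Relations in the metaplectic group -/

/-! By the Iwasawa decomposition an element `f` of the principal series is determined by `h(θ) =
f(k̃_θ)`. Since `M̃` is the cyclic group generated by `k̃_π`, the only constraints on `h` are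
smoothness and `h(θ + π) = -εi h(θ)`; conversely every such `h` extends (`kExtend_mem`). This gives
(a), and it also gives a Fourier expansion of `h` in the characters `exp(iλ_n θ)`, `λ_n = 2n - ε/2`,
with rapidly decreasing coefficients (`exists_rapidDecay_hasSum`).

For `g̃ = k̃_θ ã_u ñ₋_x` and `y = (t - x)/u²`, the Iwasawa decomposition of `g̃ s̃ ñ_t` has angle `θ
+ π/2 - arctan y` and `A`-coordinate `u⁻¹ cos(arctan y)` (`kan_mul_sTilde_mul_nTilde`). So for `Re μ
> 0` the operator is diagonal on the `K̃`-types, and its eigenvalue on the character with exponent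
`λ` is `e^{iπλ/2}` times Cauchy's integral `∫ (1 + y²)^{-(μ+1)/2} e^{iλ arctan y} dy`. That integral
equals `Γ(μ) E(μ, λ)` with `E(μ, λ) = π 2^{1-μ} / (Γ((1+μ+λ)/2) Γ((1+μ-λ)/2))`. For `λ = 1/2` it
comes from `B(μ, μ)` and the duplication formula (`cauchyIntegral_eq_half`); an integration by parts
moves `λ` by 2 (`cauchyIntegral_step`), and evenness in `λ` does the rest.

`E` is entire in `μ` and grows at most polynomially in `n`, locally uniformly in `μ`
(`exists_bound_cauchyEntire`). Against rapidly decreasing coefficients the series of the `E(μ, λ_n)`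
is therefore entire, and `Γ(μ)` times it is the continuation, with poles at most at nonpositive
integers (`exists_isIntertwiningContinuation`). Reading off one eigenvalue gives (b). For (c), the
reflection formula turns the product of the eigenvalues at `ν` and `-ν` into `(-εi) · (-π/(ν sin
πν)) · 2 cos πν`; it does not depend on `n` because `cos πλ_n = 0` (`intertwiningScalar_mul_neg`).
-/

theorem kubotaX_of_ne {g : SL(2, ℝ)} (h : g 1 0 ≠ 0) : kubotaX g = g 1 0 := if_pos h

theorem kubotaX_of_eq {g : SL(2, ℝ)} (h : g 1 0 = 0) : kubotaX g = g 1 1 :=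
  if_neg (not_not.2 h)

/-- The real Hilbert symbol is `-1` only when both entries are negative, so a single agreement of
signs makes the cocycle trivial. Most relations below are a matrix identity together with this sign
check. -/
theorem cocycle_eq_one {g h : SL(2, ℝ)}
    (H : 0 < kubotaX g * kubotaX (g * h) ∨ 0 < kubotaX h * kubotaX (g * h)) :
    cocycle g h = 1 := by
  unfold cocycle hilbertSymbol
  rw [if_neg]
  rintro ⟨h1, h2⟩
  rcases H with H | H
  · rw [div_neg_iff] at h1
    rcases h1 with ⟨a, b⟩ | ⟨a, b⟩ <;> nlinarith
  · rw [div_neg_iff] at h2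
    rcases h2 with ⟨a, b⟩ | ⟨a, b⟩ <;> nlinarith

@[simp] theorem mTilde_coe (ε₁ ε₂ : ℤˣ) : ((mTilde ε₁ ε₂).mat : Matrix (Fin 2) (Fin 2) ℝ) =
    !![((ε₁ : ℤ) : ℝ), 0; 0, ((ε₁ : ℤ) : ℝ)] := rfl
@[simp] theorem aTilde_coe (u : ℝ) (hu : 0 < u) :
    ((aTilde u hu).mat : Matrix (Fin 2) (Fin 2) ℝ) = !![u, 0; 0, u⁻¹] := rfl
@[simp] theorem nTilde_coe (x : ℝ) :
    ((nTilde x).mat : Matrix (Fin 2) (Fin 2) ℝ) = !![1, x; 0, 1] := rfl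
@[simp] theorem nMinusTilde_coe (x : ℝ) :
    ((nMinusTilde x).mat : Matrix (Fin 2) (Fin 2) ℝ) = !![1, 0; x, 1] := rfl
@[simp] theorem kTilde_coe (θ : ℝ) : ((kTilde θ).mat : Matrix (Fin 2) (Fin 2) ℝ) =
    !![Real.cos θ, -Real.sin θ; Real.sin θ, Real.cos θ] := rfl
@[simp] theorem mTilde_sgn (ε₁ ε₂ : ℤˣ) : (mTilde ε₁ ε₂).sgn = ε₂ := rfl
@[simp] theorem aTilde_sgn (u : ℝ) (hu : 0 < u) : (aTilde u hu).sgn = 1 := rfl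
@[simp] theorem nTilde_sgn (x : ℝ) : (nTilde x).sgn = 1 := rfl
@[simp] theorem nMinusTilde_sgn (x : ℝ) : (nMinusTilde x).sgn = 1 := rfl
theorem kTilde_sgn (θ : ℝ) : (kTilde θ).sgn = kSign θ := rfl

theorem kubotaX_aTilde (u : ℝ) (hu : 0 < u) : kubotaX (aTilde u hu).mat = u⁻¹ := by
  rw [kubotaX_of_eq] <;> simp

theorem kubotaX_nTilde (x : ℝ) : kubotaX (nTilde x).mat = 1 := by
  rw [kubotaX_of_eq] <;> simp

theorem kubotaX_nMinusTilde (x : ℝ) : kubotaX (nMinusTilde x).mat = if x = 0 then 1 else x := by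
  simp [kubotaX]

theorem kSign_of_mem {θ : ℝ} (h : θ ∈ Ico (-Real.pi) Real.pi) : kSign θ = 1 := by
  have hpi := Real.pi_pos
  have e : toIcoMod four_pi_pos (-(2 * Real.pi)) θ = θ := by
    rw [toIcoMod_eq_self]
    exact ⟨by linarith [h.1], by linarith [h.2]⟩
  unfold kSign
  rw [e, if_pos h]

@[simp] theorem sTilde_coe :
    (sTilde.mat : Matrix (Fin 2) (Fin 2) ℝ) = !![0, -1; 1, 0] := by
  simp [sTilde]

theorem argL_exp {θ : ℝ} (h : θ ∈ Ico (-Real.pi) Real.pi) :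
    argL (Complex.exp (θ * Complex.I)) = θ := by
  rcases h.1.eq_or_lt with h0 | h0
  · rw [← h0]
    have : Complex.exp (((-Real.pi : ℝ) : ℂ) * Complex.I) = ((-1 : ℝ) : ℂ) := by
      push_cast
      rw [neg_mul, Complex.exp_neg, Complex.exp_pi_mul_I]; norm_num
    rw [this, argL, if_pos (Complex.arg_ofReal_of_neg (by norm_num))]
  · have : Complex.arg (Complex.exp (θ * Complex.I)) = θ := by
      rw [Complex.arg_exp_mul_I, toIocMod_eq_self]
      exact ⟨h0, by linarith [h.2]⟩
    rw [argL, this, if_neg h.2.ne]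

/-- The sign records the parity of the number of full turns separating `θ` from its representative
in `[-π, π)`, and `argL` of `e^{iθ}` is that representative. This ties `kSign` to the integer-valued
cocycle of `argL_mul`. -/
theorem exists_kSign (θ : ℝ) : ∃ n : ℤ, kSign θ = (-1) ^ n ∧
    argL (Complex.exp (θ * Complex.I)) = θ - n * (2 * Real.pi) := by
  obtain ⟨hm, n, hn⟩ := (toIcoMod_eq_iff Real.two_pi_pos (a := -Real.pi) (b := θ)).1 rfl
  set t := toIcoMod Real.two_pi_pos (-Real.pi) θ
  have hm' : t ∈ Ico (-Real.pi) Real.pi := ⟨hm.1, by linarith [hm.2]⟩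
  have e : θ = t + n * (2 * Real.pi) := by rw [hn, zsmul_eq_mul]
  refine ⟨n, ?_, ?_⟩
  · rw [e, kSign_add_int_mul, kSign_of_mem hm', mul_one]
  · have : Complex.exp (θ * Complex.I) = Complex.exp (t * Complex.I) := by
      rw [e, Complex.exp_eq_exp_iff_exists_int]
      exact ⟨n, by push_cast; ring⟩
    rw [this, argL_exp hm', e]; ring

theorem autFactor_kTilde (θ : ℝ) :
    autFactor (kTilde θ).mat UpperHalfPlane.I = Complex.exp (θ * Complex.I) := by
  rw [Complex.exp_mul_I]
  simp [autFactor]; ring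

theorem kTilde_smul_I (θ : ℝ) : (kTilde θ).mat • UpperHalfPlane.I = UpperHalfPlane.I := by
  apply UpperHalfPlane.ext
  rw [UpperHalfPlane.specialLinearGroup_apply]
  simp only [kTilde_coe, Matrix.of_apply, Matrix.cons_val', Matrix.cons_val_zero,
    Matrix.cons_val_one, Matrix.cons_val_fin_one, UpperHalfPlane.coe_I]
  rw [div_eq_iff]
  · have h := Complex.I_sq
    simp
    linear_combination (-Complex.sin θ) * h
  · have := autFactor_ne_zero (kTilde θ).mat UpperHalfPlane.I
    simpa [autFactor] using this

theorem kTilde_mat_add (θ φ : ℝ) : (kTilde θ).mat * (kTilde φ).mat = (kTilde (θ + φ)).mat := by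
  apply Subtype.ext
  simp [Real.cos_add, Real.sin_add]
  constructor <;> ring

/-- Rotations fix the point `i`, and the automorphy factor there is `e^{iθ}`. Hence `argL_mul` at
`i` expresses the turns in `θ + φ` as those of `θ` plus those of `φ` plus the cocycle. -/
theorem kTilde_mul (θ φ : ℝ) : kTilde θ * kTilde φ = kTilde (θ + φ) := by
  ext1
  · exact kTilde_mat_add θ φ
  · obtain ⟨n, hn, hn'⟩ := exists_kSign θ
    obtain ⟨m, hm, hm'⟩ := exists_kSign φ
    obtain ⟨k, hk, hk'⟩ := exists_kSign (θ + φ)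
    have h := argL_mul (kTilde θ).mat (kTilde φ).mat UpperHalfPlane.I
    rw [kTilde_smul_I, kTilde_mat_add, autFactor_kTilde, autFactor_kTilde, autFactor_kTilde,
      hn', hm', hk'] at h
    have e : (k : ℝ) = ((cocycleZ (kTilde θ).mat (kTilde φ).mat + n + m : ℤ) : ℝ) := by
      have := Real.pi_pos
      have h2 : (k : ℝ) * (2 * Real.pi) =
          ((cocycleZ (kTilde θ).mat (kTilde φ).mat + n + m : ℤ) : ℝ) * (2 * Real.pi) := by
        push_cast; linarith
      exact mul_right_cancel₀ (by positivity) h2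
    rw [Mp.mul_sgn, cocycle_eq, kTilde_sgn, kTilde_sgn, kTilde_sgn, hn, hm, hk,
      ← zpow_add, ← zpow_add]
    congr 1
    exact_mod_cast e.symm

theorem aTilde_mul (u v : ℝ) (hu : 0 < u) (hv : 0 < v) :
    aTilde u hu * aTilde v hv = aTilde (u * v) (mul_pos hu hv) := by
  have hm : (aTilde u hu).mat * (aTilde v hv).mat = (aTilde (u * v) (mul_pos hu hv)).mat := by
    apply Subtype.ext; simp [mul_comm]
  ext1
  · exact hm
  · rw [Mp.mul_sgn, cocycle_eq_one]
    · simp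
    · left; rw [hm, kubotaX_aTilde, kubotaX_aTilde]; positivity

theorem nTilde_mul (x y : ℝ) : nTilde x * nTilde y = nTilde (x + y) := by
  have hm : (nTilde x).mat * (nTilde y).mat = (nTilde (x + y)).mat := by
    apply Subtype.ext; simp [add_comm]
  ext1
  · exact hm
  · rw [Mp.mul_sgn, cocycle_eq_one]
    · simp
    · left; rw [hm, kubotaX_nTilde, kubotaX_nTilde]; norm_num

theorem nMinusTilde_mul (x y : ℝ) : nMinusTilde x * nMinusTilde y = nMinusTilde (x + y) := by
  have hm : (nMinusTilde x).mat * (nMinusTilde y).mat = (nMinusTilde (x + y)).mat := by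
    apply Subtype.ext; simp
  ext1
  · exact hm
  · rw [Mp.mul_sgn, cocycle_eq_one]
    · simp
    · rw [hm, kubotaX_nMinusTilde, kubotaX_nMinusTilde, kubotaX_nMinusTilde]
      by_cases hx : x = 0
      · subst hx
        right
        by_cases hy : y = 0
        · simp [hy]
        · simp [hy]
      by_cases hy : y = 0
      · subst hy
        left
        simp [hx]
      by_cases hxy : x + y = 0
      · simp only [hx, hy, hxy, if_false, if_true, mul_one]
        rcases lt_or_gt_of_ne hx with h | h
        · right; linarith
        · left; exact h
      · simp only [hx, hy, hxy, if_false]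
        -- If both `x(x + y)` and `y(x + y)` were nonpositive, so would be their sum `(x + y)²`.
        have : 0 < (x + y) ^ 2 := by positivity
        by_contra hc
        push Not at hc
        nlinarith

theorem nTilde_mul_aTilde (t u : ℝ) (hu : 0 < u) :
    aTilde u hu * nTilde t = nTilde (u ^ 2 * t) * aTilde u hu := by
  have hm : (aTilde u hu).mat * (nTilde t).mat = (nTilde (u ^ 2 * t)).mat * (aTilde u hu).mat := by
    apply Subtype.ext; simp; field_simp
  have hX : kubotaX ((nTilde (u ^ 2 * t)).mat * (aTilde u hu).mat) = u⁻¹ := by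
    rw [kubotaX_of_eq] <;> simp
  ext1
  · exact hm
  · rw [Mp.mul_sgn, Mp.mul_sgn, cocycle_eq_one, cocycle_eq_one]
    · simp
    · left; rw [hX, kubotaX_nTilde]; positivity
    · left; rw [hm, hX, kubotaX_aTilde]; positivity

theorem nMinusTilde_mul_aTilde (x u : ℝ) (hu : 0 < u) :
    nMinusTilde x * aTilde u hu = aTilde u hu * nMinusTilde (u ^ 2 * x) := by
  have hm : (nMinusTilde x).mat * (aTilde u hu).mat =
      (aTilde u hu).mat * (nMinusTilde (u ^ 2 * x)).mat := by
    apply Subtype.ext; simp; field_simp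
  have hX : kubotaX ((aTilde u hu).mat * (nMinusTilde (u ^ 2 * x)).mat) =
      if x = 0 then u⁻¹ else u * x := by
    split_ifs with h
    · rw [kubotaX_of_eq] <;> simp [h]
    · rw [kubotaX_of_ne] <;> simp [h, hu.ne']; field_simp
  ext1
  · exact hm
  · rw [Mp.mul_sgn, Mp.mul_sgn, cocycle_eq_one, cocycle_eq_one]
    · simp
    · right; rw [hX, kubotaX_nMinusTilde]
      by_cases h : x = 0
      · simp [h, hu]
      · have : 0 < x ^ 2 := by positivity
        have h2 : u ^ 2 * x ≠ 0 := by positivity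
        rw [if_neg h2, if_neg h]
        have : u ^ 2 * x * (u * x) = u ^ 3 * x ^ 2 := by ring
        rw [this]; positivity
    · left; rw [hm, hX, kubotaX_nMinusTilde]
      by_cases h : x = 0
      · simp [h, hu]
      · have : 0 < x ^ 2 := by positivity
        rw [if_neg h, if_neg h]
        have : x * (u * x) = u * x ^ 2 := by ring
        rw [this]; positivity

theorem nMinusTilde_mul_sTilde (x : ℝ) : nMinusTilde x * sTilde = sTilde * nTilde (-x) := by
  have hm : (nMinusTilde x).mat * sTilde.mat = sTilde.mat * (nTilde (-x)).mat := by
    apply Subtype.ext; simp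
  have hX : kubotaX (sTilde.mat * (nTilde (-x)).mat) = 1 := by
    rw [kubotaX_of_ne] <;> simp
  have hs : kubotaX sTilde.mat = 1 := by
    rw [kubotaX_of_ne] <;> simp
  ext1
  · exact hm
  · rw [Mp.mul_sgn, Mp.mul_sgn, cocycle_eq_one, cocycle_eq_one]
    · simp
    · left; rw [hX, hs]; norm_num
    · right; rw [hm, hX, hs]; norm_num

theorem aTilde_mul_sTilde (u : ℝ) (hu : 0 < u) :
    aTilde u hu * sTilde = sTilde * aTilde u⁻¹ (inv_pos.2 hu) := by
  have hm : (aTilde u hu).mat * sTilde.mat = sTilde.mat * (aTilde u⁻¹ (inv_pos.2 hu)).mat := by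
    apply Subtype.ext; simp
  have hX : kubotaX (sTilde.mat * (aTilde u⁻¹ (inv_pos.2 hu)).mat) = u⁻¹ := by
    rw [kubotaX_of_ne] <;> simp [hu.ne']
  have hs : kubotaX sTilde.mat = 1 := by
    rw [kubotaX_of_ne] <;> simp
  ext1
  · exact hm
  · rw [Mp.mul_sgn, Mp.mul_sgn, cocycle_eq_one, cocycle_eq_one]
    · simp
    · left; rw [hX, hs]; positivity
    · right; rw [hm, hX, hs]; positivity

theorem one_add_sq_pos (y : ℝ) : 0 < 1 + y ^ 2 := by positivity

/-- The Iwasawa decomposition of `ñ_y`. -/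
theorem nTilde_eq (y : ℝ) : nTilde y = kTilde (-Real.arctan y) *
    aTilde (√(1 + y ^ 2))⁻¹ (inv_pos.2 (Real.sqrt_pos.2 (one_add_sq_pos y))) *
      nMinusTilde (y / (1 + y ^ 2)) := by
  set r := √(1 + y ^ 2) with hr
  have hr0 : 0 < r := Real.sqrt_pos.2 (one_add_sq_pos y)
  have hr2 : 1 + y ^ 2 = r ^ 2 := (Real.sq_sqrt (one_add_sq_pos y).le).symm
  have hc : Real.cos (Real.arctan y) = r⁻¹ := by rw [Real.cos_arctan, one_div]
  have hs : Real.sin (Real.arctan y) = y * r⁻¹ := by rw [Real.sin_arctan]; rfl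
  have hm : (nTilde y).mat = (kTilde (-Real.arctan y) * aTilde r⁻¹ (inv_pos.2 hr0) *
      nMinusTilde (y / (1 + y ^ 2))).mat := by
    apply Subtype.ext
    rw [kan_mat]
    simp only [Real.cos_neg, Real.sin_neg, hc, hs, inv_inv, nTilde_coe, hr2]
    ext i j
    fin_cases i <;> fin_cases j <;> simp
    · field_simp
      linarith
    · field_simp
    · field_simp
      ring
    · field_simp
  have hmem : -Real.arctan y ∈ Ico (-Real.pi) Real.pi :=
    ⟨by linarith [Real.arctan_lt_pi_div_two y, Real.pi_pos],
      by linarith [Real.neg_pi_div_two_lt_arctan y, Real.pi_pos]⟩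
  have hka : kubotaX ((kTilde (-Real.arctan y)).mat * (aTilde r⁻¹ (inv_pos.2 hr0)).mat) =
      if y = 0 then 1 else -y * r⁻¹ ^ 2 := by
    split_ifs with h
    · have : r = 1 := by rw [hr, h]; norm_num
      rw [kubotaX_of_eq] <;> simp [h, this]
    · rw [kubotaX_of_ne] <;> simp [hs, h, hr0.ne']; ring
  have hk : kubotaX (kTilde (-Real.arctan y)).mat = if y = 0 then 1 else -y * r⁻¹ := by
    split_ifs with h
    · rw [kubotaX_of_eq] <;> simp [h]
    · rw [kubotaX_of_ne] <;> simp [hs, h, hr0.ne']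
  ext1
  · exact hm
  · rw [Mp.mul_sgn, Mp.mul_sgn, Mp.mul_mat, cocycle_eq_one, cocycle_eq_one, kTilde_sgn,
      kSign_of_mem hmem]
    · simp
    · left
      rw [hk, hka]
      split_ifs with h
      · norm_num
      · have : -y * r⁻¹ * (-y * r⁻¹ ^ 2) = y ^ 2 * r⁻¹ ^ 3 := by ring
        rw [this]; positivity
    · rw [← Mp.mul_mat, ← Mp.mul_mat, ← hm, kubotaX_nTilde, Mp.mul_mat, hka, kubotaX_nMinusTilde,
        mul_one, mul_one]
      by_cases h : y = 0
      · simp [h]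
      -- The lower left entries of the two factors have opposite signs, so exactly one agrees in
      -- sign with the value 1 of `kubotaX` on the product.
      · rw [if_neg h, if_neg (div_ne_zero h (one_add_sq_pos y).ne')]
        rcases lt_or_gt_of_ne h with h' | h'
        · left
          have : 0 < -y := by linarith
          positivity
        · right; positivity

theorem exists_kan (g : Mp) : ∃ (θ u x : ℝ) (hu : 0 < u),
    g = kTilde θ * aTilde u hu * nMinusTilde x := by
  obtain ⟨p, rfl⟩ := iwasawa_surjective g
  exact ⟨_, _, _, _, rfl⟩

/-- Conjugation by `s̃` turns `ñ₋_x` into `ñ_{-x}` and `ã_u` into its inverse, and moving `ã_{1/u}`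
past `ñ_{t-x}` rescales the variable by `u⁻²`; then `nTilde_eq` applies. The `Ñ₋`-coordinate is left
unspecified because the functions at hand do not depend on it. -/
theorem kan_mul_sTilde_mul_nTilde (θ u x t : ℝ) (hu : 0 < u) :
    ∃ z : ℝ, kTilde θ * aTilde u hu * nMinusTilde x * sTilde * nTilde t =
      kTilde (θ + Real.pi / 2 - Real.arctan ((t - x) / u ^ 2)) *
        aTilde ((√(1 + ((t - x) / u ^ 2) ^ 2))⁻¹ * u⁻¹)
          (mul_pos (inv_pos.2 (Real.sqrt_pos.2 (one_add_sq_pos _))) (inv_pos.2 hu)) *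
        nMinusTilde z := by
  refine ⟨u⁻¹ ^ 2 * ((t - x) / u ^ 2 / (1 + ((t - x) / u ^ 2) ^ 2)), ?_⟩
  have e1 : nMinusTilde x * sTilde * nTilde t = sTilde * nTilde (t - x) := by
    rw [nMinusTilde_mul_sTilde, mul_assoc, nTilde_mul]; congr 2; ring
  have e2 : aTilde u⁻¹ (inv_pos.2 hu) * nTilde (t - x) =
      nTilde ((t - x) / u ^ 2) * aTilde u⁻¹ (inv_pos.2 hu) := by
    rw [nTilde_mul_aTilde]; congr 2; field_simp
  calc kTilde θ * aTilde u hu * nMinusTilde x * sTilde * nTilde t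
      = kTilde θ * (aTilde u hu * (nMinusTilde x * sTilde * nTilde t)) := by
        simp only [mul_assoc]
    _ = kTilde θ * ((aTilde u hu * sTilde) * nTilde (t - x)) := by rw [e1, mul_assoc]
    _ = kTilde θ * (sTilde * (aTilde u⁻¹ (inv_pos.2 hu) * nTilde (t - x))) := by
        rw [aTilde_mul_sTilde, mul_assoc]
    _ = kTilde θ * sTilde * nTilde ((t - x) / u ^ 2) * aTilde u⁻¹ (inv_pos.2 hu) := by
        rw [e2]; simp only [mul_assoc]
    _ = _ := by
        rw [nTilde_eq ((t - x) / u ^ 2), sTilde, kTilde_mul, ← mul_assoc, ← mul_assoc, kTilde_mul,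
          mul_assoc _ _ (aTilde u⁻¹ _), nMinusTilde_mul_aTilde, ← mul_assoc,
          mul_assoc _ (aTilde _ _) (aTilde _ _), aTilde_mul]
        congr 3

/-- On commuting matrices the cocycle is symmetric, since the Hilbert symbol is; so a central matrix
lifts to a central element. -/
theorem mTilde_comm (ε₁ ε₂ : ℤˣ) (g : Mp) : mTilde ε₁ ε₂ * g = g * mTilde ε₁ ε₂ := by
  have hm : (mTilde ε₁ ε₂).mat * g.mat = g.mat * (mTilde ε₁ ε₂).mat := by
    apply Subtype.ext
    ext i j
    fin_cases i <;> fin_cases j <;> simp [Matrix.mul_apply, mul_comm]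
  ext1
  · exact hm
  · simp only [Mp.mul_sgn, cocycle, hm, hilbertSymbol, and_comm, mul_right_comm]

theorem kSign_pi : kSign Real.pi = -1 := by
  have := kSign_add_two_pi (-Real.pi)
  rw [kSign_of_mem ⟨le_refl _, by linarith [Real.pi_pos]⟩] at this
  rw [← this]; congr 1; ring

/-- `M̃` is cyclic of order four, generated by `k̃_π`. The four identities from here on place it
inside `K̃`, so that equivariance under `M̃` becomes quasi-periodicity in `θ`. -/
theorem mTilde_one_one : mTilde 1 1 = 1 := by
  ext1
  · apply Subtype.ext; ext i j; fin_cases i <;> fin_cases j <;> simp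
  · rfl

theorem mTilde_one_neg_one : mTilde 1 (-1) = kTilde (2 * Real.pi) := by
  ext1
  · apply Subtype.ext; simp
  · have := kSign_add_two_pi 0
    rw [kSign_of_mem ⟨by linarith [Real.pi_pos], Real.pi_pos⟩, zero_add] at this
    exact this.symm

theorem mTilde_neg_one_neg_one : mTilde (-1) (-1) = kTilde Real.pi := by
  ext1
  · apply Subtype.ext; simp
  · exact kSign_pi.symm

theorem mTilde_neg_one_one : mTilde (-1) 1 = kTilde (-Real.pi) := by
  ext1
  · apply Subtype.ext; simp
  · exact (kSign_of_mem ⟨le_refl _, by linarith [Real.pi_pos]⟩).symm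

theorem units_mul_I_sq (ε : ℤˣ) : (((ε : ℤ) : ℂ) * Complex.I) * (((ε : ℤ) : ℂ) * Complex.I) = -1 := by
  rcases Int.units_eq_one_or ε with rfl | rfl <;> simp

/-! ### Principal series and their restrictions to `K̃` -/

theorem apply_eq_of_mem {ε : ℤˣ} {ν : ℂ} {f : Mp → ℂ} (hf : f ∈ principalSeries ε ν) (g : Mp)
    (ε₁ ε₂ : ℤˣ) (u : ℝ) (hu : 0 < u) (x : ℝ) :
    f g = omegaChar ε ν ε₁ ε₂ u * f (g * (mTilde ε₁ ε₂ * aTilde u hu * nMinusTilde x)) := by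
  have := hf.2 (g * (mTilde ε₁ ε₂ * aTilde u hu * nMinusTilde x))
    (mTilde ε₁ ε₂ * aTilde u hu * nMinusTilde x)⁻¹ ε₁ ε₂ u hu x (inv_inv _)
  rwa [mul_assoc, mul_inv_cancel, mul_one] at this

theorem cpow_mul_cpow_neg {u : ℝ} (hu : 0 < u) (z : ℂ) : (u : ℂ) ^ z * (u : ℂ) ^ (-z) = 1 := by
  have : (u : ℂ) ≠ 0 := by exact_mod_cast hu.ne'
  rw [← Complex.cpow_add _ _ this, add_neg_cancel, Complex.cpow_zero]

theorem apply_kan_of_mem {ε : ℤˣ} {ν : ℂ} {f : Mp → ℂ} (hf : f ∈ principalSeries ε ν)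
    (θ u x : ℝ) (hu : 0 < u) :
    f (kTilde θ * aTilde u hu * nMinusTilde x) = (u : ℂ) ^ (1 - ν) * f (kTilde θ) := by
  rw [apply_eq_of_mem hf (kTilde θ) 1 1 u hu x, mTilde_one_one, one_mul, ← mul_assoc,
    omegaChar, sigmaChar, if_pos rfl, ← mul_assoc]
  have := cpow_mul_cpow_neg hu (1 - ν)
  rw [neg_sub] at this
  simp [this, mul_assoc]

/-- The generator `k̃_π = m̃_{-1,-1}` has `σ_ε = εi`, and right translation by it multiplies `f` by
the inverse, `-εi`. -/
theorem apply_kTilde_add_pi_of_mem {ε : ℤˣ} {ν : ℂ} {f : Mp → ℂ} (hf : f ∈ principalSeries ε ν)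
    (θ : ℝ) : f (kTilde (θ + Real.pi)) = -(((ε : ℤ) : ℂ) * Complex.I) * f (kTilde θ) := by
  have h := apply_eq_of_mem hf (kTilde θ) (-1) (-1) 1 one_pos 0
  have h1 : aTilde 1 one_pos * nMinusTilde 0 = 1 := by
    have : aTilde 1 one_pos = 1 := by
      ext1
      · apply Subtype.ext; ext i j; fin_cases i <;> fin_cases j <;> simp
      · rfl
    rw [this, one_mul]
    ext1
    · apply Subtype.ext; ext i j; fin_cases i <;> fin_cases j <;> simp
    · rfl
  rw [mul_assoc (mTilde _ _), h1, mul_one, mTilde_neg_one_neg_one, kTilde_mul] at h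
  rw [h, omegaChar, sigmaChar, if_neg (by decide)]
  have := units_mul_I_sq ε
  simp only [Units.val_neg, Units.val_one, Int.cast_neg, Int.cast_one, Complex.ofReal_one,
    Complex.one_cpow]
  linear_combination (f (kTilde (θ + Real.pi))) * this

theorem iwasawaChart_iwasawa (p : {w : ℂ // w ≠ 0} × ℝ) :
    iwasawaChart (iwasawa p) = ((p.1 : ℂ), p.2) := by
  have : iwasawaHomeomorph.symm (iwasawa p) = p := iwasawaHomeomorph.symm_apply_apply p
  rw [iwasawaChart, this]

theorem iwasawaChart_kan (θ u x : ℝ) (hu : 0 < u) :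
    iwasawaChart (kTilde θ * aTilde u hu * nMinusTilde x) =
      (u * Complex.exp ((θ / 2 : ℝ) * Complex.I), x) := by
  rw [← iwasawa_polar, iwasawaChart_iwasawa]

theorem kTilde_eq_kan (θ : ℝ) : kTilde θ = kTilde θ * aTilde 1 one_pos * nMinusTilde 0 := by
  have h0 : aTilde 1 one_pos = 1 := by
    ext1
    · apply Subtype.ext; ext i j; fin_cases i <;> fin_cases j <;> simp
    · rfl
  have h1 : nMinusTilde 0 = 1 := by
    ext1
    · apply Subtype.ext; ext i j; fin_cases i <;> fin_cases j <;> simp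
    · rfl
  rw [h0, h1, mul_one, mul_one]

instance : Nonempty Mp := ⟨1⟩

/-- In the global chart this curve is `(e^{iθ/2}, 0)`. -/
theorem contMDiff_kTilde : ContMDiff 𝓘(ℝ, ℝ) 𝓘(ℝ, ℂ × ℝ) ∞ kTilde := by
  refine ContMDiff.of_comp_isOpenEmbedding iwasawaChart_isOpenEmbedding ?_
  have : iwasawaChart ∘ kTilde = fun θ : ℝ =>
      ((1 : ℝ) * Complex.exp ((θ / 2 : ℝ) * Complex.I), (0 : ℝ)) := by
    ext1 θ
    rw [Function.comp_apply, kTilde_eq_kan, iwasawaChart_kan]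
  rw [this, contMDiff_iff_contDiff]
  refine ContDiff.prodMk ?_ contDiff_const
  refine contDiff_const.mul (ContDiff.cexp (ContDiff.mul ?_ contDiff_const))
  exact Complex.ofRealCLM.contDiff.comp (contDiff_id.div_const 2)

theorem contDiff_comp_kTilde {ε : ℤˣ} {ν : ℂ} {f : Mp → ℂ} (hf : f ∈ principalSeries ε ν) :
    ContDiff ℝ ∞ (fun θ => f (kTilde θ)) :=
  (hf.1.comp contMDiff_kTilde).contDiff

/-- The function on the group with `k̃_θ ã_u ñ₋_x ↦ u^{1-ν} h(θ)`. -/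
def kExtend (ν : ℂ) (h : ℝ → ℂ) (g : Mp) : ℂ :=
  (‖(iwasawaChart g).1‖ : ℂ) ^ (1 - ν) * h (2 * Complex.arg (iwasawaChart g).1)

/-- A multiplier with `c² = -1` has `c⁴ = 1`, so `h` has period `4π`. This is exactly the ambiguity
of twice the argument of a complex number, and makes `kExtend` independent of the branch of `arg`.
-/
theorem add_int_mul_of_quasiperiodic {c : ℂ} {h : ℝ → ℂ} (hc : c * c = -1)
    (hq : ∀ θ, h (θ + Real.pi) = c * h θ) (θ : ℝ) (n : ℤ) :
    h (θ + n * (4 * Real.pi)) = h θ := by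
  have hp : Function.Periodic h (4 * Real.pi) := by
    intro θ
    have : θ + 4 * Real.pi = θ + Real.pi + Real.pi + Real.pi + Real.pi := by ring
    rw [this, hq, hq, hq, hq]
    linear_combination (c * c - 1) * h θ * hc
  exact hp.int_mul n θ

theorem kExtend_kan {c : ℂ} {h : ℝ → ℂ} (hc : c * c = -1)
    (hq : ∀ θ, h (θ + Real.pi) = c * h θ) (ν : ℂ) (θ u x : ℝ) (hu : 0 < u) :
    kExtend ν h (kTilde θ * aTilde u hu * nMinusTilde x) = (u : ℂ) ^ (1 - ν) * h θ := by
  have h1 : ‖(u : ℂ) * Complex.exp ((θ / 2 : ℝ) * Complex.I)‖ = u := by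
    rw [norm_mul, Complex.norm_exp_ofReal_mul_I, mul_one, Complex.norm_real, Real.norm_eq_abs,
      abs_of_pos hu]
  rw [kExtend, iwasawaChart_kan, h1, Complex.arg_real_mul _ hu, Complex.arg_exp_mul_I, toIocMod]
  rw [← add_int_mul_of_quasiperiodic hc hq θ (-toIocDiv Real.two_pi_pos (-Real.pi) (θ / 2))]
  congr 2
  simp only [zsmul_eq_mul]
  push_cast
  ring

theorem kExtend_kTilde {c : ℂ} {h : ℝ → ℂ} (hc : c * c = -1)
    (hq : ∀ θ, h (θ + Real.pi) = c * h θ) (ν : ℂ) (θ : ℝ) :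
    kExtend ν h (kTilde θ) = h θ := by
  rw [kTilde_eq_kan, kExtend_kan hc hq]; simp

theorem contDiffAt_arg {w : ℂ} (hw : w ∈ Complex.slitPlane) : ContDiffAt ℝ ∞ Complex.arg w := by
  have h : ContDiffAt ℝ ∞ Complex.log w := (Complex.contDiffAt_log hw).restrict_scalars ℝ
  have := Complex.imCLM.contDiff.contDiffAt.comp w h
  exact this.congr_of_eventuallyEq (Filter.Eventually.of_forall fun z => (Complex.log_im z).symm)

/-- Only the cut along the negative real axis needs care. Near it `arg(-w)` is smooth, and twice it
differs from `2 arg w` by `2π` modulo `4π`, which changes `h` only by a sign. -/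
theorem contDiffAt_comp_arg {c : ℂ} {h : ℝ → ℂ} (hc : c * c = -1)
    (hq : ∀ θ, h (θ + Real.pi) = c * h θ) (hh : ContDiff ℝ ∞ h) {w : ℂ} (hw : w ≠ 0) :
    ContDiffAt ℝ ∞ (fun w => h (2 * Complex.arg w)) w := by
  have h2 : ∀ θ, h (θ + 2 * Real.pi) = -h θ := fun θ => by
    have : θ + 2 * Real.pi = θ + Real.pi + Real.pi := by ring
    rw [this, hq, hq]; linear_combination h θ * hc
  by_cases hs : w ∈ Complex.slitPlane
  · exact hh.contDiffAt.comp w (contDiffAt_const.mul (contDiffAt_arg hs))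
  · have hs' : -w ∈ Complex.slitPlane := by
      rw [Complex.mem_slitPlane_iff] at hs ⊢
      push Not at hs
      left
      rcases hs.1.eq_or_lt with h0 | h0
      · exact absurd (Complex.ext h0 hs.2) hw
      · simpa using h0
    have e : (fun w => h (2 * Complex.arg w)) =ᶠ[nhds w] fun w => -h (2 * Complex.arg (-w)) := by
      filter_upwards [isOpen_ne.mem_nhds hw] with z hz
      have := Complex.arg_neg_coe_angle hz
      rw [← Real.Angle.coe_add, Real.Angle.angle_eq_iff_two_pi_dvd_sub] at this
      obtain ⟨k, hk⟩ := this
      have : 2 * Complex.arg (-z) = 2 * Complex.arg z + 2 * Real.pi + k * (4 * Real.pi) := by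
        linarith
      rw [this, add_int_mul_of_quasiperiodic hc hq, h2, neg_neg]
    refine ContDiffAt.congr_of_eventuallyEq ?_ e
    exact (hh.contDiffAt.comp w (contDiffAt_const.mul
      ((contDiffAt_arg hs').comp w contDiffAt_id.neg))).neg

theorem iwasawaChart_fst_ne_zero (g : Mp) : (iwasawaChart g).1 ≠ 0 :=
  (iwasawaHomeomorph.symm g).1.2

theorem contMDiff_kExtend {c : ℂ} {h : ℝ → ℂ} (hc : c * c = -1)
    (hq : ∀ θ, h (θ + Real.pi) = c * h θ) (hh : ContDiff ℝ ∞ h) (ν : ℂ) :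
    ContMDiff 𝓘(ℝ, ℂ × ℝ) 𝓘(ℝ, ℂ) ∞ (kExtend ν h) := by
  intro g
  have h0 := iwasawaChart_fst_ne_zero g
  have hchart : ContMDiffAt 𝓘(ℝ, ℂ × ℝ) 𝓘(ℝ, ℂ × ℝ) ∞ iwasawaChart g :=
    (contMDiff_isOpenEmbedding (n := ∞) (I := 𝓘(ℝ, ℂ × ℝ)) iwasawaChart_isOpenEmbedding) g
  have hn : ContDiffAt ℝ ∞ (fun w : ℂ => (‖w‖ : ℂ) ^ (1 - ν)) (iwasawaChart g).1 := by
    have e : (fun w : ℂ => (‖w‖ : ℂ) ^ (1 - ν)) =ᶠ[nhds (iwasawaChart g).1]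
        fun w => Complex.exp ((Real.log ‖w‖ : ℝ) * (1 - ν)) := by
      filter_upwards [isOpen_ne.mem_nhds h0] with w hw
      rw [Complex.cpow_def_of_ne_zero (by simpa using hw), Complex.ofReal_log (norm_nonneg _)]
    refine ContDiffAt.congr_of_eventuallyEq ?_ e
    refine ContDiffAt.cexp (ContDiffAt.mul ?_ contDiffAt_const)
    exact Complex.ofRealCLM.contDiff.contDiffAt.comp _
      ((contDiffAt_norm ℝ h0).log (norm_ne_zero_iff.2 h0))
  have hΦ : ContDiffAt ℝ ∞ (fun p : ℂ × ℝ => (‖p.1‖ : ℂ) ^ (1 - ν) * h (2 * Complex.arg p.1))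
      (iwasawaChart g) :=
    (hn.mul (contDiffAt_comp_arg hc hq hh h0)).comp (iwasawaChart g) contDiffAt_fst
  exact hΦ.contMDiffAt.comp g hchart

/-- As `M̃` is central and `Ã` normalises `Ñ₋`, right multiplication by `m̃ ã_u ñ₋_x` multiplies the
`K̃`-part by `m̃` and the `A`-coordinate by `u`. The first effect is the quasi-periodicity of `h`,
the second the factor `u^{1-ν}`. -/
theorem kExtend_mem {ε : ℤˣ} {h : ℝ → ℂ} (hh : ContDiff ℝ ∞ h)
    (hq : ∀ θ, h (θ + Real.pi) = -(((ε : ℤ) : ℂ) * Complex.I) * h θ) (ν : ℂ) :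
    kExtend ν h ∈ principalSeries ε ν := by
  have hc : -(((ε : ℤ) : ℂ) * Complex.I) * -(((ε : ℤ) : ℂ) * Complex.I) = -1 := by
    rw [neg_mul_neg, units_mul_I_sq]
  refine ⟨contMDiff_kExtend hc hq hh ν, ?_⟩
  intro g b ε₁ ε₂ u hu x hb
  obtain ⟨g', rfl⟩ : ∃ g', g = g' * b⁻¹ := ⟨g * b, by simp⟩
  rw [mul_assoc, inv_mul_cancel, mul_one, hb]
  obtain ⟨θ, v, y, hv, rfl⟩ := exists_kan g'
  have e : kTilde θ * aTilde v hv * nMinusTilde y *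
      (mTilde ε₁ ε₂ * aTilde u hu * nMinusTilde x) = kTilde θ * mTilde ε₁ ε₂ *
        aTilde (v * u) (mul_pos hv hu) * nMinusTilde (u ^ 2 * y + x) := by
    calc _ = kTilde θ * aTilde v hv * (nMinusTilde y * mTilde ε₁ ε₂) * aTilde u hu *
          nMinusTilde x := by simp only [mul_assoc]
      _ = kTilde θ * (aTilde v hv * mTilde ε₁ ε₂) * (nMinusTilde y * aTilde u hu) *
          nMinusTilde x := by rw [← mTilde_comm]; simp only [mul_assoc]
      _ = kTilde θ * mTilde ε₁ ε₂ * (aTilde v hv * aTilde u hu) *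
          (nMinusTilde (u ^ 2 * y) * nMinusTilde x) := by
          rw [← mTilde_comm, nMinusTilde_mul_aTilde]; simp only [mul_assoc]
      _ = _ := by rw [aTilde_mul, nMinusTilde_mul]
  have hm : ∃ φ : ℝ, kTilde θ * mTilde ε₁ ε₂ = kTilde φ ∧ sigmaChar ε ε₁ ε₂ * h φ = h θ := by
    have h2 : h (θ + 2 * Real.pi) = -h θ := by
      have : θ + 2 * Real.pi = θ + Real.pi + Real.pi := by ring
      rw [this, hq, hq]; linear_combination h θ * hc
    rcases Int.units_eq_one_or ε₁ with rfl | rfl <;> rcases Int.units_eq_one_or ε₂ with rfl | rfl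
    · exact ⟨θ, by rw [mTilde_one_one, mul_one], by simp [sigmaChar]⟩
    · exact ⟨θ + 2 * Real.pi, by rw [mTilde_one_neg_one, kTilde_mul], by simp [sigmaChar, h2]⟩
    · refine ⟨θ + -Real.pi, by rw [mTilde_neg_one_one, kTilde_mul], ?_⟩
      have := hq (θ + -Real.pi)
      rw [neg_add_cancel_right] at this
      rw [this, sigmaChar, if_neg (by decide)]
      simp
    · refine ⟨θ + Real.pi, by rw [mTilde_neg_one_neg_one, kTilde_mul], ?_⟩
      rw [hq, sigmaChar, if_neg (by decide)]
      have := units_mul_I_sq ε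
      simp
      linear_combination (-h θ) * this
  obtain ⟨φ, hφ, hφ'⟩ := hm
  rw [e, hφ, kExtend_kan hc hq, kExtend_kan hc hq, omegaChar, ← hφ']
  have hmul : ((v * u : ℝ) : ℂ) ^ (1 - ν) = (v : ℂ) ^ (1 - ν) * (u : ℂ) ^ (1 - ν) := by
    rw [Complex.ofReal_mul, Complex.mul_cpow_ofReal_nonneg hv.le hu.le]
  have := cpow_mul_cpow_neg hu (1 - ν)
  rw [neg_sub] at this
  rw [hmul]
  linear_combination (-(v : ℂ) ^ (1 - ν) * sigmaChar ε ε₁ ε₂ * h φ) * this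

theorem eq_of_eqOn_kTilde {ε : ℤˣ} {ν : ℂ} {f f' : Mp → ℂ} (hf : f ∈ principalSeries ε ν)
    (hf' : f' ∈ principalSeries ε ν) (h : ∀ θ, f (kTilde θ) = f' (kTilde θ)) : f = f' := by
  ext g
  obtain ⟨θ, u, x, hu, rfl⟩ := exists_kan g
  rw [apply_kan_of_mem hf, apply_kan_of_mem hf', h]

theorem existsUnique_isKVector (ε : ℤˣ) (ν : ℂ) (ℓ : ℤ) (hℓ : Even ℓ) :
    ∃! φ : Mp → ℂ, IsKVector ε ν ℓ φ := by
  set h : ℝ → ℂ := fun θ =>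
    Complex.exp (-((ε : ℤ) : ℂ) * (1 / 2 + (ℓ : ℂ)) * Complex.I * (θ : ℂ)) with hdef
  have hh : ContDiff ℝ ∞ h :=
    (contDiff_const.mul Complex.ofRealCLM.contDiff).cexp
  have hq : ∀ θ, h (θ + Real.pi) = -(((ε : ℤ) : ℂ) * Complex.I) * h θ := by
    intro θ
    -- Evenness of `ℓ` is what makes the multiplier right: `e^{-εiπℓ} = 1`, leaving `e^{-εiπ/2} =
    -- -εi`.
    obtain ⟨m, rfl⟩ := hℓ
    have e1 : Complex.exp (-((ε : ℤ) : ℂ) * (1 / 2 + ((m + m : ℤ) : ℂ)) * Complex.I * Real.pi) =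
        -(((ε : ℤ) : ℂ) * Complex.I) := by
      rcases Int.units_eq_one_or ε with rfl | rfl
      · have : -(((1 : ℤˣ) : ℤ) : ℂ) * (1 / 2 + ((m + m : ℤ) : ℂ)) * Complex.I * Real.pi =
          -(Real.pi / 2 * Complex.I) + (-m : ℤ) * (2 * Real.pi * Complex.I) := by push_cast; ring
        rw [this, Complex.exp_add, Complex.exp_int_mul_two_pi_mul_I, Complex.exp_neg,
          Complex.exp_pi_div_two_mul_I]
        simp
      · have : -(((-1 : ℤˣ) : ℤ) : ℂ) * (1 / 2 + ((m + m : ℤ) : ℂ)) * Complex.I * Real.pi =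
          (Real.pi / 2 * Complex.I) + (m : ℤ) * (2 * Real.pi * Complex.I) := by push_cast; ring
        rw [this, Complex.exp_add, Complex.exp_int_mul_two_pi_mul_I,
          Complex.exp_pi_div_two_mul_I]
        simp
    simp only [hdef]
    rw [← e1, ← Complex.exp_add]
    congr 1; push_cast; ring
  have hc : -(((ε : ℤ) : ℂ) * Complex.I) * -(((ε : ℤ) : ℂ) * Complex.I) = -1 := by
    rw [neg_mul_neg, units_mul_I_sq]
  refine ⟨kExtend ν h, ⟨kExtend_mem hh hq ν, fun θ => kExtend_kTilde hc hq ν θ⟩, ?_⟩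
  intro φ hφ
  refine eq_of_eqOn_kTilde hφ.1 (kExtend_mem hh hq ν) fun θ => ?_
  rw [hφ.2 θ, kExtend_kTilde hc hq]

open Filter Topology

/-! ### The integral `∫ (1 + y²)^{-(μ+1)/2} exp(i λ arctan y) dy` -/

/-- `cos (arctan y)`. -/
def cosArctan (y : ℝ) : ℝ := (√(1 + y ^ 2))⁻¹

theorem cosArctan_pos (y : ℝ) : 0 < cosArctan y :=
  inv_pos.2 (Real.sqrt_pos.2 (one_add_sq_pos y))

theorem cosArctan_sq (y : ℝ) : cosArctan y ^ 2 = (1 + y ^ 2)⁻¹ := by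
  rw [cosArctan, inv_pow, Real.sq_sqrt (one_add_sq_pos y).le]

theorem cos_arctan_eq (y : ℝ) : Real.cos (Real.arctan y) = cosArctan y := by
  rw [Real.cos_arctan, one_div]; rfl

theorem sin_arctan_eq (y : ℝ) : Real.sin (Real.arctan y) = y * cosArctan y := by
  rw [Real.sin_arctan]; rfl

theorem cosArctan_le_one (y : ℝ) : cosArctan y ≤ 1 := by
  rw [← cos_arctan_eq]; exact Real.cos_le_one _

theorem cosArctan_neg (y : ℝ) : cosArctan (-y) = cosArctan y := by
  simp [cosArctan]

theorem continuous_cosArctan : Continuous cosArctan := by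
  have : cosArctan = fun y => Real.cos (Real.arctan y) := funext fun y => (cos_arctan_eq y).symm
  rw [this]; exact Real.continuous_cos.comp Real.continuous_arctan

theorem hasDerivAt_log_cosArctan (y : ℝ) :
    HasDerivAt (fun y => Real.log (cosArctan y)) (-(y * cosArctan y ^ 2)) y := by
  have e : (fun y => Real.log (cosArctan y)) = fun y => -(1 / 2) * Real.log (1 + y ^ 2) := by
    ext y
    rw [cosArctan, Real.log_inv, Real.log_sqrt (one_add_sq_pos y).le]; ring
  rw [e]
  have h : HasDerivAt (fun y : ℝ => 1 + y ^ 2) (2 * y) y := by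
    simpa using (hasDerivAt_pow 2 y).const_add 1
  refine ((h.log (one_add_sq_pos y).ne').const_mul (-(1 / 2))).congr_deriv ?_
  rw [cosArctan_sq]; field_simp

theorem hasDerivAt_arctan_cosArctan (y : ℝ) :
    HasDerivAt Real.arctan (cosArctan y ^ 2) y := by
  rw [cosArctan_sq]; simpa using Real.hasDerivAt_arctan y

theorem ofReal_cpow_eq_exp {u : ℝ} (hu : 0 < u) (z : ℂ) :
    (u : ℂ) ^ z = Complex.exp ((Real.log u : ℝ) * z) := by
  rw [Complex.cpow_def_of_ne_zero (by exact_mod_cast hu.ne'), Complex.ofReal_log hu.le]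

/-- `(1 + y²)^{-(μ+1)/2} exp(i λ arctan y)`. -/
def cauchyIntegrand (μ : ℂ) (l : ℝ) (y : ℝ) : ℂ :=
  (cosArctan y : ℂ) ^ (μ + 1) * Complex.exp ((l * Real.arctan y : ℝ) * Complex.I)

/-- `∫ (1 + y²)^{-(μ+1)/2} exp(i λ arctan y) dy`. -/
def cauchyIntegral (μ : ℂ) (l : ℝ) : ℂ := ∫ y, cauchyIntegrand μ l y

theorem continuous_cosArctan_cpow (z : ℂ) : Continuous fun y => (cosArctan y : ℂ) ^ z := by
  refine (Complex.continuous_ofReal.comp continuous_cosArctan).cpow continuous_const fun y => ?_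
  exact Complex.ofReal_mem_slitPlane.2 (cosArctan_pos y)

theorem norm_cosArctan_cpow (z : ℂ) (y : ℝ) : ‖(cosArctan y : ℂ) ^ z‖ = cosArctan y ^ z.re :=
  Complex.norm_cpow_eq_rpow_re_of_pos (cosArctan_pos y) z

theorem integrable_cosArctan_cpow {μ : ℂ} (hμ : 0 < μ.re) :
    Integrable fun y => (cosArctan y : ℂ) ^ (μ + 1) := by
  have h := integrable_rpow_neg_one_add_norm_sq (E := ℝ) (μ := volume) (r := μ.re + 1)
    (by simpa using hμ)
  refine h.mono' (continuous_cosArctan_cpow _).aestronglyMeasurable (Eventually.of_forall fun y => ?_)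
  rw [norm_cosArctan_cpow, cosArctan, Real.sqrt_eq_rpow, ← Real.rpow_neg (one_add_sq_pos y).le,
    ← Real.rpow_mul (one_add_sq_pos y).le]
  simp only [Complex.add_re, Complex.one_re, Real.norm_eq_abs, sq_abs]
  apply le_of_eq; congr 1; ring

theorem norm_cauchyIntegrand (μ : ℂ) (l y : ℝ) :
    ‖cauchyIntegrand μ l y‖ = cosArctan y ^ (μ.re + 1) := by
  rw [cauchyIntegrand, norm_mul, Complex.norm_exp_ofReal_mul_I, mul_one, norm_cosArctan_cpow]
  simp

theorem continuous_cauchyIntegrand (μ : ℂ) (l : ℝ) : Continuous (cauchyIntegrand μ l) := by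
  refine (continuous_cosArctan_cpow _).mul ?_
  have := Real.continuous_arctan
  fun_prop

theorem integrable_cauchyIntegrand {μ : ℂ} (hμ : 0 < μ.re) (l : ℝ) :
    Integrable (cauchyIntegrand μ l) := by
  refine (integrable_cosArctan_cpow hμ).mono (continuous_cauchyIntegrand μ l).aestronglyMeasurable
    (Eventually.of_forall fun y => ?_)
  rw [norm_cauchyIntegrand, norm_cosArctan_cpow]; simp

theorem cauchyIntegral_neg (μ : ℂ) (l : ℝ) : cauchyIntegral μ (-l) = cauchyIntegral μ l := by
  unfold cauchyIntegral
  rw [← integral_neg_eq_self]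
  congr 1; ext y
  simp [cauchyIntegrand, cosArctan_neg, Real.arctan_neg]

/-- For `Re μ ≥ 1` the integrand is dominated by `(1 + y²)⁻¹`. The bound is uniform in `λ`, which
starts the induction in `exists_bound_cauchyEntire`. -/
theorem norm_cauchyIntegral_le {μ : ℂ} (hμ : 1 ≤ μ.re) (l : ℝ) :
    ‖cauchyIntegral μ l‖ ≤ Real.pi := by
  rw [← integral_univ_inv_one_add_sq]
  refine norm_integral_le_of_norm_le integrable_inv_one_add_sq (Eventually.of_forall fun y => ?_)
  rw [norm_cauchyIntegrand, ← cosArctan_sq, ← Real.rpow_natCast]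
  refine Real.rpow_le_rpow_of_exponent_ge (cosArctan_pos y) (cosArctan_le_one y) ?_
  push_cast; linarith

theorem tendsto_log_cosArctan {F : Filter ℝ} (hF : Tendsto (fun y : ℝ => y ^ 2) F atTop) :
    Tendsto (fun y => Real.log (cosArctan y)) F atBot := by
  have e : (fun y => Real.log (cosArctan y)) = fun y => -((1 / 2) * Real.log (1 + y ^ 2)) := by
    ext y
    rw [cosArctan, Real.log_inv, Real.log_sqrt (one_add_sq_pos y).le]; ring
  rw [e]
  refine tendsto_neg_atTop_atBot.comp (Tendsto.const_mul_atTop (by norm_num) ?_)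
  exact Real.tendsto_log_atTop.comp (tendsto_atTop_add_const_left _ _ hF)

/-- With `φ = arctan y`, the derivative of `-2i (cos φ)^μ e^{ilφ}` is the difference of the two
integrands with their coefficients, once `sin φ` and `cos φ` are written through `e^{±iφ}`. The
primitive vanishes at both ends because `Re μ > 0`. -/
theorem cauchyIntegral_step {μ : ℂ} (hμ : 0 < μ.re) (l : ℝ) :
    (μ + l) * cauchyIntegral μ (l + 1) = (μ - l) * cauchyIntegral μ (l - 1) := by
  set G : ℝ → ℂ := fun y =>
    Complex.exp ((Real.log (cosArctan y) : ℝ) * μ + (l * Real.arctan y : ℝ) * Complex.I) with hG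
  set G' : ℝ → ℂ := fun y => (μ + l) * cauchyIntegrand μ (l + 1) y -
    (μ - l) * cauchyIntegrand μ (l - 1) y with hG'
  have hd : ∀ y, HasDerivAt (fun y => -2 * Complex.I * G y) (G' y) y := by
    intro y
    have h1 := ((hasDerivAt_log_cosArctan y).ofReal_comp.mul_const μ).add
      (((hasDerivAt_arctan_cosArctan y).const_mul l).ofReal_comp.mul_const Complex.I)
    refine (h1.cexp.const_mul (-2 * Complex.I)).congr_deriv ?_
    have hs := sin_arctan_eq y
    have hc := cos_arctan_eq y
    have ep : Complex.exp (((l + 1) * Real.arctan y : ℝ) * Complex.I) =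
        Complex.exp ((l * Real.arctan y : ℝ) * Complex.I) *
          (cosArctan y + y * cosArctan y * Complex.I) := by
      have : (((l + 1) * Real.arctan y : ℝ) : ℂ) * Complex.I =
        (l * Real.arctan y : ℝ) * Complex.I + (Real.arctan y : ℝ) * Complex.I := by
        push_cast; ring
      rw [this, Complex.exp_add, Complex.exp_mul_I (Real.arctan y : ℝ), ← Complex.ofReal_cos,
        ← Complex.ofReal_sin, hs, hc]
      push_cast; ring
    have em : Complex.exp (((l - 1) * Real.arctan y : ℝ) * Complex.I) =
        Complex.exp ((l * Real.arctan y : ℝ) * Complex.I) *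
          (cosArctan y - y * cosArctan y * Complex.I) := by
      have : (((l - 1) * Real.arctan y : ℝ) : ℂ) * Complex.I =
        (l * Real.arctan y : ℝ) * Complex.I + (-Real.arctan y : ℝ) * Complex.I := by
        push_cast; ring
      rw [this, Complex.exp_add, Complex.exp_mul_I (-Real.arctan y : ℝ), ← Complex.ofReal_cos,
        ← Complex.ofReal_sin, Real.cos_neg, Real.sin_neg, hs, hc]
      push_cast; ring
    have ec : (cosArctan y : ℂ) ^ (μ + 1) =
        Complex.exp ((Real.log (cosArctan y) : ℝ) * μ) * cosArctan y := by
      rw [ofReal_cpow_eq_exp (cosArctan_pos y), mul_add, Complex.exp_add, mul_one,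
        ← Complex.ofReal_exp, Real.exp_log (cosArctan_pos y)]
    simp only [hG', cauchyIntegrand, ep, em, ec, Complex.exp_add, Pi.add_apply]
    push_cast [-Complex.ofReal_arctan]
    linear_combination (-2 * l * Complex.exp (Real.log (cosArctan y) * μ) *
      Complex.exp (l * (Real.arctan y : ℝ) * Complex.I) * (cosArctan y) ^ 2) * Complex.I_sq
  have hi1 := (integrable_cauchyIntegrand hμ (l + 1)).const_mul (μ + l)
  have hi2 := (integrable_cauchyIntegrand hμ (l - 1)).const_mul (μ - l)
  have ht : ∀ F : Filter ℝ, Tendsto (fun y : ℝ => y ^ 2) F atTop →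
      Tendsto (fun y => -2 * Complex.I * G y) F (𝓝 0) := by
    intro F hF
    rw [← mul_zero (-2 * Complex.I)]
    refine Tendsto.const_mul _ ?_
    rw [tendsto_zero_iff_norm_tendsto_zero]
    have : (fun y => ‖G y‖) = fun y => Real.exp (Real.log (cosArctan y) * μ.re) := by
      ext y; simp [hG, Complex.norm_exp, -Complex.ofReal_arctan]
    rw [this]
    exact Real.tendsto_exp_atBot.comp ((tendsto_log_cosArctan hF).atBot_mul_const hμ)
  have hF2 : Tendsto (fun y : ℝ => y ^ 2) atBot atTop := by
    have := (tendsto_pow_atTop (α := ℝ) two_ne_zero).comp tendsto_neg_atBot_atTop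
    simpa [Function.comp_def] using this
  have key := integral_of_hasDerivAt_of_tendsto hd (hi1.sub hi2) (ht _ hF2)
    (ht _ (tendsto_pow_atTop two_ne_zero))
  rw [hG', integral_sub hi1 hi2, integral_const_mul, integral_const_mul, sub_zero] at key
  exact sub_eq_zero.1 key

/-! ### Cauchy's integral for `λ = 1/2` from the beta integral -/

theorem sqrt_two_mul_sin_arctan_strictMono :
    StrictMono fun y : ℝ => (1 + √2 * Real.sin (Real.arctan y / 2)) / 2 := by
  intro y z hyz
  have h1 := Real.arctan_strictMono hyz
  have := Real.neg_pi_div_two_lt_arctan y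
  have := Real.arctan_lt_pi_div_two z
  have hpi := Real.pi_pos
  have h2 : Real.sin (Real.arctan y / 2) < Real.sin (Real.arctan z / 2) :=
    Real.sin_lt_sin_of_lt_of_le_pi_div_two (by linarith) (by linarith) (by linarith)
  have h3 : 0 < √2 := by positivity
  have := mul_lt_mul_of_pos_left h2 h3
  simp only
  linarith

theorem image_sqrt_two_mul_sin_arctan :
    (fun y : ℝ => (1 + √2 * Real.sin (Real.arctan y / 2)) / 2) '' univ = Ioo 0 1 := by
  have h3 : 0 < √2 := by positivity
  have h22 : √2 * √2 = 2 := Real.mul_self_sqrt (by norm_num)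
  have hpi := Real.pi_pos
  have hs4 := Real.sin_pi_div_four
  ext x
  constructor
  · rintro ⟨y, -, rfl⟩
    have := Real.neg_pi_div_two_lt_arctan y
    have := Real.arctan_lt_pi_div_two y
    have h2 : Real.sin (Real.arctan y / 2) < Real.sin (Real.pi / 4) :=
      Real.sin_lt_sin_of_lt_of_le_pi_div_two (by linarith) (by linarith) (by linarith)
    have h1 : Real.sin (-(Real.pi / 4)) < Real.sin (Real.arctan y / 2) :=
      Real.sin_lt_sin_of_lt_of_le_pi_div_two (by linarith) (by linarith) (by linarith)
    rw [Real.sin_neg] at h1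
    rw [hs4] at h1 h2
    constructor <;> simp only <;> nlinarith
  · rintro ⟨hx0, hx1⟩
    set z := (2 * x - 1) / √2 with hz
    have hzz : √2 * z = 2 * x - 1 := by rw [hz]; field_simp
    have hz1 : z < Real.sin (Real.pi / 4) := by
      rw [hs4, hz, div_lt_iff₀ h3]; nlinarith
    have hz2 : Real.sin (-(Real.pi / 4)) < z := by
      rw [Real.sin_neg, hs4, hz, lt_div_iff₀ h3]; nlinarith
    have ha1 : Real.arcsin z < Real.pi / 4 :=
      (Real.arcsin_lt_iff_lt_sin' ⟨by linarith, by linarith⟩).2 hz1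
    have ha2 : -(Real.pi / 4) < Real.arcsin z :=
      (Real.lt_arcsin_iff_sin_lt' ⟨by linarith, by linarith⟩).2 hz2
    refine ⟨Real.tan (2 * Real.arcsin z), trivial, ?_⟩
    simp only
    have hsq : √2 / 2 < 1 := by nlinarith
    rw [Real.arctan_tan (by linarith) (by linarith), mul_div_cancel_left₀ _ two_ne_zero,
      Real.sin_arcsin, hzz]
    · ring
    · rw [Real.sin_neg, hs4] at hz2; linarith
    · rw [hs4] at hz1; linarith

/-- The substitution `x = (1 + √2 sin(φ/2))/2`, `φ = arctan y`, carries `ℝ` onto `(0, 1)` and is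
chosen so that `x(1 - x) = (1 - 2 sin²(φ/2))/4 = (cos φ)/4`. Its derivative supplies the factor
`cos(φ/2)`. -/
theorem betaIntegral_eq_integral (μ : ℂ) : Complex.betaIntegral μ μ =
    ∫ y : ℝ, (√2 / 4 : ℝ) * (4 : ℂ) ^ (1 - μ) *
      ((cosArctan y : ℂ) ^ (μ + 1) * (Real.cos (Real.arctan y / 2) : ℝ)) := by
  rw [Complex.betaIntegral, intervalIntegral.integral_of_le zero_le_one,
    integral_Ioc_eq_integral_Ioo, ← image_sqrt_two_mul_sin_arctan,
    integral_image_eq_integral_abs_deriv_smul MeasurableSet.univ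
      (f' := fun y => √2 / 4 * Real.cos (Real.arctan y / 2) * cosArctan y ^ 2) _
      sqrt_two_mul_sin_arctan_strictMono.injective.injOn, setIntegral_univ]
  · congr 1; ext y
    have hp := Real.neg_pi_div_two_lt_arctan y
    have hp' := Real.arctan_lt_pi_div_two y
    have hpi := Real.pi_pos
    have hcos : 0 < Real.cos (Real.arctan y / 2) :=
      Real.cos_pos_of_mem_Ioo ⟨by linarith, by linarith⟩
    have hc := cosArctan_pos y
    rw [abs_of_pos (by positivity)]
    obtain ⟨hx0, hx1⟩ : (1 + √2 * Real.sin (Real.arctan y / 2)) / 2 ∈ Ioo (0 : ℝ) 1 := by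
      rw [← image_sqrt_two_mul_sin_arctan]; exact ⟨y, trivial, rfl⟩
    set x := (1 + √2 * Real.sin (Real.arctan y / 2)) / 2 with hx
    have hxx : x * (1 - x) = 4⁻¹ * cosArctan y := by
      have h22 : √2 ^ 2 = 2 := Real.sq_sqrt (by norm_num)
      have hdbl : cosArctan y = 1 - 2 * Real.sin (Real.arctan y / 2) ^ 2 := by
        rw [← cos_arctan_eq, Real.sin_sq_eq_half_sub, mul_div_cancel₀ _ (two_ne_zero' ℝ)]; ring
      rw [hdbl, hx]
      linear_combination (-(1 / 4) * Real.sin (Real.arctan y / 2) ^ 2) * h22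
    have e1 : (x : ℂ) ^ (μ - 1) * (1 - (x : ℂ)) ^ (μ - 1) =
        (4 : ℂ) ^ (1 - μ) * (cosArctan y : ℂ) ^ (μ - 1) := by
      have : (1 - (x : ℂ)) = ((1 - x : ℝ) : ℂ) := by push_cast; ring
      rw [this, ← Complex.mul_cpow_ofReal_nonneg hx0.le (by linarith), ← Complex.ofReal_mul, hxx,
        Complex.ofReal_mul, Complex.mul_cpow_ofReal_nonneg (by norm_num) hc.le]
      congr 1
      have : (1 - μ) = -(μ - 1) := by ring
      rw [this, Complex.cpow_neg, Complex.ofReal_inv, Complex.inv_cpow]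
      · norm_num
      · rw [show ((4 : ℝ) : ℂ) = (4 : ℕ) by norm_num, Complex.natCast_arg]
        exact hpi.ne
    have e2 : (cosArctan y : ℂ) ^ (μ + 1) = (cosArctan y : ℂ) ^ (μ - 1) * (cosArctan y : ℂ) ^ 2 := by
      rw [show μ + 1 = μ - 1 + (2 : ℕ) by push_cast; ring,
        Complex.cpow_add _ _ (by exact_mod_cast hc.ne'), Complex.cpow_natCast]
    rw [e1, e2, Complex.real_smul]
    push_cast
    ring
  · intro y _
    apply HasDerivAt.hasDerivWithinAt
    have h := ((((hasDerivAt_arctan_cosArctan y).div_const 2).sin.const_mul √2).const_add 1).div_const 2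
    refine h.congr_deriv ?_
    ring

theorem two_cpow_ne_zero (z : ℂ) : (2 : ℂ) ^ z ≠ 0 := by
  rw [Ne, Complex.cpow_eq_zero_iff]; simp

/-- Since `cos(φ/2)` is the mean of `e^{±iφ/2}` and Cauchy's integral is even in `λ`,
`betaIntegral_eq_integral` makes `B(μ, μ) = Γ(μ)²/Γ(2μ)` a multiple of the integral. Duplication at
`μ` then trades `Γ(2μ)` for `Γ(μ + 1/2)`. -/
theorem cauchyIntegral_half {μ : ℂ} (hμ : 0 < μ.re) : cauchyIntegral μ (1 / 2) *
    Complex.Gamma (μ + 1 / 2) = (√2 : ℝ) * (√Real.pi : ℝ) * Complex.Gamma μ := by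
  have h1 : Complex.betaIntegral μ μ = (√2 / 4 : ℝ) * (4 : ℂ) ^ (1 - μ) *
      cauchyIntegral μ (1 / 2) := by
    rw [betaIntegral_eq_integral, integral_const_mul]
    congr 1
    have i1 := integrable_cauchyIntegrand hμ (1 / 2)
    have i2 := integrable_cauchyIntegrand hμ (-(1 / 2))
    have e : ∀ y : ℝ, (cosArctan y : ℂ) ^ (μ + 1) * (Real.cos (Real.arctan y / 2) : ℝ) =
        (1 / 2) * (cauchyIntegrand μ (1 / 2) y + cauchyIntegrand μ (-(1 / 2)) y) := by
      intro y
      rw [cauchyIntegrand, cauchyIntegrand, Complex.ofReal_cos, Complex.cos]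
      have a1 : ((1 / 2 * Real.arctan y : ℝ) : ℂ) * Complex.I =
        ((Real.arctan y / 2 : ℝ) : ℂ) * Complex.I := by push_cast; ring
      have a2 : ((-(1 / 2) * Real.arctan y : ℝ) : ℂ) * Complex.I =
        -((Real.arctan y / 2 : ℝ) : ℂ) * Complex.I := by push_cast; ring
      rw [a1, a2]; ring
    simp_rw [e]
    have h12 := cauchyIntegral_neg μ (1 / 2)
    rw [integral_const_mul, integral_add i1 i2]
    unfold cauchyIntegral at h12 ⊢
    rw [h12]; ring
  have h2 := Complex.Gamma_mul_Gamma_eq_betaIntegral hμ hμ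
  have h3 := Complex.Gamma_mul_Gamma_add_half μ
  rw [← two_mul, h1] at h2
  have hΓ : Complex.Gamma μ ≠ 0 := Complex.Gamma_ne_zero_of_re_pos hμ
  have hΓ2 : Complex.Gamma (2 * μ) ≠ 0 := Complex.Gamma_ne_zero_of_re_pos (by simpa using hμ)
  have h4 : (4 : ℂ) ^ (1 - μ) = 2 * 2 ^ (1 - 2 * μ) := by
    have : (4 : ℂ) ^ (1 - μ) = 2 ^ (1 - μ) * 2 ^ (1 - μ) := by
      have := Complex.mul_cpow_ofReal_nonneg (a := 2) (b := 2) (by norm_num) (by norm_num) (1 - μ)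
      norm_num at this
      exact this
    rw [this, ← Complex.cpow_add _ _ two_ne_zero,
      show 1 - μ + (1 - μ) = 1 + (1 - 2 * μ) by ring, Complex.cpow_add _ _ two_ne_zero,
      Complex.cpow_one]
  rw [h4] at h2
  have h22 : ((√2 : ℝ) : ℂ) * (√2 : ℝ) = 2 := by
    rw [← Complex.ofReal_mul, Real.mul_self_sqrt (by norm_num)]; norm_num
  have h2p := two_cpow_ne_zero (1 - 2 * μ)
  apply mul_left_cancel₀ (mul_ne_zero hΓ hΓ2)
  push_cast at h2 ⊢
  have h5 : Complex.Gamma (2 * μ) * cauchyIntegral μ (1 / 2) * 2 ^ (1 - 2 * μ) =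
      √2 * (Complex.Gamma μ * Complex.Gamma μ) := by
    linear_combination (-√2) * h2 - (Complex.Gamma (2 * μ) * 2 ^ (1 - 2 * μ) *
      cauchyIntegral μ (1 / 2) / 2) * h22
  calc Complex.Gamma μ * Complex.Gamma (2 * μ) *
        (cauchyIntegral μ (1 / 2) * Complex.Gamma (μ + 1 / 2))
      = Complex.Gamma (2 * μ) * cauchyIntegral μ (1 / 2) *
        (Complex.Gamma μ * Complex.Gamma (μ + 1 / 2)) := by ring
    _ = _ := by rw [h3]; linear_combination (Complex.Gamma (2 * μ) * √Real.pi) * h5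

/-- The entire function `π 2^{1-μ} / (Γ((1+μ+λ)/2) Γ((1+μ-λ)/2))` of `μ`. -/
def cauchyEntire (μ : ℂ) (l : ℝ) : ℂ := Real.pi * 2 ^ (1 - μ) *
  ((Complex.Gamma ((1 + μ + l) / 2))⁻¹ * (Complex.Gamma ((1 + μ - l) / 2))⁻¹)

theorem cauchyEntire_neg (μ : ℂ) (l : ℝ) : cauchyEntire μ (-l) = cauchyEntire μ l := by
  unfold cauchyEntire
  rw [mul_comm (Complex.Gamma ((1 + μ + l) / 2))⁻¹]
  push_cast
  rw [← sub_eq_add_neg, sub_neg_eq_add]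

theorem differentiable_cauchyEntire (l : ℝ) : Differentiable ℂ fun μ => cauchyEntire μ l := by
  have h1 : Differentiable ℂ fun μ : ℂ => (2 : ℂ) ^ (1 - μ) :=
    ((differentiable_const 1).sub differentiable_id).const_cpow (Or.inl two_ne_zero)
  have h2 : Differentiable ℂ fun μ : ℂ => (Complex.Gamma ((1 + μ + l) / 2))⁻¹ :=
    Complex.differentiable_one_div_Gamma.comp (by fun_prop)
  have h3 : Differentiable ℂ fun μ : ℂ => (Complex.Gamma ((1 + μ - l) / 2))⁻¹ :=
    Complex.differentiable_one_div_Gamma.comp (by fun_prop)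
  exact (h1.const_mul _).mul (h2.mul h3)

/-- This is the recursion of `cauchyIntegral_step`. Working with `1/Γ(z) = z/Γ(z + 1)` keeps it
valid at the poles of `Γ`. -/
theorem cauchyEntire_step (μ : ℂ) (l : ℝ) :
    (μ + l) * cauchyEntire μ (l + 1) = (μ - l) * cauchyEntire μ (l - 1) := by
  have h1 := Complex.one_div_Gamma_eq_self_mul_one_div_Gamma_add_one ((μ - l) / 2)
  have h2 := Complex.one_div_Gamma_eq_self_mul_one_div_Gamma_add_one ((μ + l) / 2)
  unfold cauchyEntire
  rw [show (1 + μ + ((l + 1 : ℝ) : ℂ)) / 2 = (μ + l) / 2 + 1 by push_cast; ring,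
    show (1 + μ - ((l + 1 : ℝ) : ℂ)) / 2 = (μ - l) / 2 by push_cast; ring,
    show (1 + μ + ((l - 1 : ℝ) : ℂ)) / 2 = (μ + l) / 2 by push_cast; ring,
    show (1 + μ - ((l - 1 : ℝ) : ℂ)) / 2 = (μ - l) / 2 + 1 by push_cast; ring, h1, h2]
  ring

/-- It moves estimates two units to the left in `μ`, at the cost of a factor quadratic in `λ`. -/
theorem cauchyEntire_add_two (μ : ℂ) (l : ℝ) :
    cauchyEntire μ l = ((μ + 1) ^ 2 - l ^ 2) * cauchyEntire (μ + 2) l := by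
  have h1 := Complex.one_div_Gamma_eq_self_mul_one_div_Gamma_add_one ((1 + μ + l) / 2)
  have h2 := Complex.one_div_Gamma_eq_self_mul_one_div_Gamma_add_one ((1 + μ - l) / 2)
  have h3 : (2 : ℂ) ^ (1 - μ) = 4 * 2 ^ (1 - (μ + 2)) := by
    rw [show (1 - μ) = (1 - (μ + 2)) + (2 : ℕ) by push_cast; ring,
      Complex.cpow_add _ _ two_ne_zero, Complex.cpow_natCast]
    norm_num; ring
  unfold cauchyEntire
  rw [h1, h2, h3, show (1 + (μ + 2) + l) / 2 = (1 + μ + l) / 2 + 1 by ring,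
    show (1 + (μ + 2) - l) / 2 = (1 + μ - l) / 2 + 1 by ring]
  ring

/-- A second duplication, at `μ/2 + 1/4`, splits the `Γ(μ + 1/2)` of `cauchyIntegral_half` into the
two gamma factors of `cauchyEntire`. -/
theorem cauchyIntegral_eq_half {μ : ℂ} (hμ : 0 < μ.re) :
    cauchyIntegral μ (1 / 2) = Complex.Gamma μ * cauchyEntire μ (1 / 2) := by
  have h1 := cauchyIntegral_half hμ
  have h2 := Complex.Gamma_mul_Gamma_add_half (μ / 2 + 1 / 4)
  have r1 : 0 < (μ + 1 / 2).re := by simp; linarith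
  have g1 : Complex.Gamma (μ + 1 / 2) ≠ 0 := Complex.Gamma_ne_zero_of_re_pos r1
  have g2 : Complex.Gamma (μ / 2 + 1 / 4) ≠ 0 := Complex.Gamma_ne_zero_of_re_pos (by
    have : (μ / 2 + 1 / 4 : ℂ) = ((1 / 2 : ℝ) : ℂ) * (μ + 1 / 2) := by push_cast; ring
    rw [this, Complex.re_ofReal_mul]; linarith)
  have g3 : Complex.Gamma (μ / 2 + 1 / 4 + 1 / 2) ≠ 0 := Complex.Gamma_ne_zero_of_re_pos (by
    have : (μ / 2 + 1 / 4 + 1 / 2 : ℂ) = ((1 / 2 : ℝ) : ℂ) * (μ + 1 / 2) + ((1 / 2 : ℝ) : ℂ) := by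
      push_cast; ring
    rw [this, Complex.add_re, Complex.re_ofReal_mul, Complex.ofReal_re]; linarith)
  unfold cauchyEntire
  rw [show (1 + μ + ((1 / 2 : ℝ) : ℂ)) / 2 = μ / 2 + 1 / 4 + 1 / 2 by push_cast; ring,
    show (1 + μ - ((1 / 2 : ℝ) : ℂ)) / 2 = μ / 2 + 1 / 4 by push_cast; ring]
  rw [show 2 * (μ / 2 + 1 / 4) = μ + 1 / 2 by ring,
    show 1 - (μ + 1 / 2) = 1 - μ + ((-(1 / 2) : ℝ) : ℂ) by push_cast; ring,
    Complex.cpow_add _ _ two_ne_zero] at h2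
  have h22 : (2 : ℂ) ^ ((-(1 / 2) : ℝ) : ℂ) * (√2 : ℝ) = 1 := by
    have : (2 : ℂ) = ((2 : ℝ) : ℂ) := by norm_num
    rw [this, ← Complex.ofReal_cpow (by norm_num), ← Complex.ofReal_mul, Real.sqrt_eq_rpow,
      ← Real.rpow_add (by norm_num)]
    norm_num
  have hpi : ((√Real.pi : ℝ) : ℂ) * (√Real.pi : ℝ) = Real.pi := by
    rw [← Complex.ofReal_mul, Real.mul_self_sqrt Real.pi_pos.le]
  have hs2 : ((√2 : ℝ) : ℂ) ≠ 0 := by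
    have : (√2 : ℝ) ≠ 0 := by positivity
    exact_mod_cast this
  apply mul_right_cancel₀ g1
  rw [h1, ← mul_inv, mul_comm (Complex.Gamma (μ / 2 + 1 / 4 + 1 / 2)), ← mul_assoc, ← div_eq_mul_inv,
    div_mul_eq_mul_div, eq_div_iff (mul_ne_zero g2 g3), h2]
  linear_combination (Complex.Gamma μ * Complex.Gamma (μ + 1 / 2) * 2 ^ (1 - μ)) *
    ((√Real.pi : ℝ) * (√Real.pi : ℝ) * h22 + hpi)

theorem cauchyIntegral_eq_of_even {μ : ℂ} (hμ : 0 < μ.re) (m : ℤ) :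
    cauchyIntegral μ (1 / 2 + 2 * m) = Complex.Gamma μ * cauchyEntire μ (1 / 2 + 2 * m) := by
  induction m using Int.induction_on with
  | zero => simpa using cauchyIntegral_eq_half hμ
  | succ n ih =>
    set l : ℝ := 1 / 2 + 2 * n + 1 with hl
    have e1 := cauchyIntegral_step hμ l
    have e2 := cauchyEntire_step μ l
    -- Going up, `l > 0`, and in the downward step `l < 0`; since `Re μ > 0`, the coefficient to be
    -- cancelled has positive real part in each case.
    have hne : μ + l ≠ 0 := by
      intro h
      have := congrArg Complex.re h
      have h0 : (0 : ℝ) ≤ n := n.cast_nonneg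
      simp at this
      linarith
    have a1 : 1 / 2 + 2 * (((n : ℤ) + 1 : ℤ) : ℝ) = l + 1 := by push_cast; linarith
    have a2 : 1 / 2 + 2 * ((n : ℤ) : ℝ) = l - 1 := by push_cast; linarith
    rw [a2] at ih
    rw [a1]
    apply mul_left_cancel₀ hne
    rw [e1, ih]
    linear_combination (-Complex.Gamma μ) * e2
  | pred n ih =>
    set l : ℝ := 1 / 2 + 2 * (-n) - 1 with hl
    have e1 := cauchyIntegral_step hμ l
    have e2 := cauchyEntire_step μ l
    have hne : μ - l ≠ 0 := by
      intro h
      have := congrArg Complex.re h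
      have h0 : (0 : ℝ) ≤ n := n.cast_nonneg
      simp at this
      linarith
    have a1 : 1 / 2 + 2 * ((-(n : ℤ) : ℤ) : ℝ) = l + 1 := by push_cast; linarith
    have a2 : 1 / 2 + 2 * ((-(n : ℤ) - 1 : ℤ) : ℝ) = l - 1 := by push_cast; linarith
    rw [a1] at ih
    rw [a2]
    apply mul_left_cancel₀ hne
    rw [← e1, ih]
    linear_combination (Complex.Gamma μ) * e2

/-- The `K̃`-type exponents `λ_n = 2n - ε/2`. -/
def kExponent (ε : ℤˣ) (n : ℤ) : ℝ := 2 * n - ((ε : ℤ) : ℝ) / 2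

theorem cauchyIntegral_kExponent {μ : ℂ} (hμ : 0 < μ.re) (ε : ℤˣ) (n : ℤ) :
    cauchyIntegral μ (kExponent ε n) = Complex.Gamma μ * cauchyEntire μ (kExponent ε n) := by
  rcases Int.units_eq_one_or ε with rfl | rfl
  · have : kExponent 1 n = -(1 / 2 + 2 * ((-n : ℤ) : ℝ)) := by
      simp [kExponent]; ring
    rw [this, cauchyIntegral_neg, cauchyEntire_neg, cauchyIntegral_eq_of_even hμ]
  · have : kExponent (-1) n = 1 / 2 + 2 * (n : ℝ) := by
      simp [kExponent]; ring
    rw [this, cauchyIntegral_eq_of_even hμ]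

/-! ### Polynomial growth of the eigenvalues in the `K̃`-type -/

theorem kExponent_sq_le (ε : ℤˣ) (n : ℤ) : 1 + kExponent ε n ^ 2 ≤ 8 * (1 + (n : ℝ) ^ 2) := by
  rcases Int.units_eq_one_or ε with rfl | rfl <;> simp [kExponent] <;>
    nlinarith [sq_nonneg ((n : ℝ) - 1), sq_nonneg ((n : ℝ) + 1)]

/-- For `Re μ ≥ 1` the function is Cauchy's integral divided by `Γ(μ)`, hence bounded uniformly in
`n`. Each use of `cauchyEntire_add_two` extends the half-plane by 2 and costs one factor `1 + n²`;
the radius is quantified inside the induction because `μ + 2` lies in a larger disc. -/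
theorem exists_bound_cauchyEntire (ε : ℤˣ) (k : ℕ) : ∀ R : ℝ, ∃ C : ℝ, 0 ≤ C ∧
    ∀ μ : ℂ, ‖μ‖ ≤ R → 1 - 2 * (k : ℝ) ≤ μ.re → ∀ n : ℤ,
      ‖cauchyEntire μ (kExponent ε n)‖ ≤ C * (1 + (n : ℝ) ^ 2) ^ k := by
  induction k with
  | zero =>
    intro R
    obtain ⟨C, hC⟩ := (isCompact_closedBall (0 : ℂ) R).exists_bound_of_continuousOn
      Complex.differentiable_one_div_Gamma.continuous.continuousOn
    refine ⟨|C| * Real.pi, by positivity, fun μ hμ hre n => ?_⟩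
    have hre1 : 1 ≤ μ.re := by simpa using hre
    have h0 : 0 < μ.re := by linarith
    have h1 := cauchyIntegral_kExponent h0 ε n
    have h2 : cauchyEntire μ (kExponent ε n) =
        (Complex.Gamma μ)⁻¹ * cauchyIntegral μ (kExponent ε n) := by
      rw [h1, inv_mul_cancel_left₀ (Complex.Gamma_ne_zero_of_re_pos h0)]
    rw [h2, norm_mul, pow_zero, mul_one]
    exact mul_le_mul ((hC μ (by simpa using hμ)).trans (le_abs_self C))
      (norm_cauchyIntegral_le hre1 _) (norm_nonneg _) (abs_nonneg C)
  | succ k ih =>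
    intro R
    obtain ⟨C, hC0, hC⟩ := ih (R + 2)
    refine ⟨8 * ((R + 1) ^ 2 + 1) * C, by positivity, fun μ hμ hre n => ?_⟩
    have hR : 0 ≤ R := (norm_nonneg _).trans hμ
    have h1 := hC (μ + 2) ((norm_add_le _ _).trans (by simpa using hμ))
      (by push_cast at hre; simp; linarith) n
    have h2 : ‖(μ + 1) ^ 2 - (kExponent ε n : ℂ) ^ 2‖ ≤
        8 * ((R + 1) ^ 2 + 1) * (1 + (n : ℝ) ^ 2) := by
      have a1 : ‖(μ + 1) ^ 2‖ ≤ (R + 1) ^ 2 := by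
        rw [norm_pow]
        exact pow_le_pow_left₀ (norm_nonneg _) ((norm_add_le _ _).trans (by simpa using hμ)) 2
      have a2 : ‖(kExponent ε n : ℂ) ^ 2‖ = kExponent ε n ^ 2 := by
        rw [norm_pow, Complex.norm_real, Real.norm_eq_abs, sq_abs]
      have a3 := kExponent_sq_le ε n
      have a4 : 0 ≤ (R + 1) ^ 2 * (n : ℝ) ^ 2 := by positivity
      refine (norm_sub_le _ _).trans ?_
      rw [a2]
      nlinarith [sq_nonneg (R + 1)]
    rw [cauchyEntire_add_two, norm_mul]
    calc _ ≤ 8 * ((R + 1) ^ 2 + 1) * (1 + (n : ℝ) ^ 2) * (C * (1 + (n : ℝ) ^ 2) ^ k) :=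
          mul_le_mul h2 h1 (norm_nonneg _) (by positivity)
      _ = _ := by ring

/-! ### Rapidly decreasing sequences -/

/-- Rapidly decreasing sequences indexed by `ℤ`. -/
def RapidDecay (b : ℤ → ℂ) : Prop := ∀ k : ℕ, ∃ C : ℝ, ∀ n : ℤ, ‖b n‖ * (1 + (n : ℝ) ^ 2) ^ k ≤ C

theorem summable_inv_one_add_sq : Summable fun n : ℤ => (1 + (n : ℝ) ^ 2)⁻¹ := by
  have h := (Real.summable_one_div_int_pow (p := 2)).2 one_lt_two
  refine Summable.of_norm_bounded_eventually h ?_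
  rw [Filter.eventually_cofinite]
  refine (Set.finite_singleton (0 : ℤ)).subset fun n hn => ?_
  by_contra h0
  apply hn
  have h1 : (n : ℝ) ≠ 0 := by exact_mod_cast h0
  have h2 : 0 < (n : ℝ) ^ 2 := by positivity
  rw [Real.norm_of_nonneg (by positivity), one_div]
  exact inv_anti₀ h2 (by linarith)

theorem RapidDecay.exists_bound {b : ℤ → ℂ} (hb : RapidDecay b) (k : ℕ) :
    ∃ C : ℝ, 0 ≤ C ∧ ∀ n : ℤ, ‖b n‖ * (1 + (n : ℝ) ^ 2) ^ k ≤ C * (1 + (n : ℝ) ^ 2)⁻¹ := by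
  obtain ⟨C, hC⟩ := hb (k + 1)
  refine ⟨C, (by positivity : 0 ≤ ‖b 0‖ * (1 + ((0 : ℤ) : ℝ) ^ 2) ^ (k + 1)).trans (hC 0),
    fun n => ?_⟩
  have h0 : 0 < 1 + (n : ℝ) ^ 2 := by positivity
  rw [← div_eq_mul_inv, le_div_iff₀ h0, mul_assoc, ← pow_succ]
  exact hC n

theorem RapidDecay.mul {b a : ℤ → ℂ} (hb : RapidDecay b) {C : ℝ} {k : ℕ}
    (ha : ∀ n : ℤ, ‖a n‖ ≤ C * (1 + (n : ℝ) ^ 2) ^ k) : RapidDecay fun n => b n * a n := by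
  intro j
  obtain ⟨D, hD⟩ := hb (k + j)
  have hC : 0 ≤ C := by
    have := (norm_nonneg _).trans (ha 0)
    simpa using this
  refine ⟨C * D, fun n => ?_⟩
  rw [norm_mul]
  calc ‖b n‖ * ‖a n‖ * (1 + (n : ℝ) ^ 2) ^ j
      ≤ ‖b n‖ * (C * (1 + (n : ℝ) ^ 2) ^ k) * (1 + (n : ℝ) ^ 2) ^ j := by
        gcongr; exact ha n
    _ = C * (‖b n‖ * (1 + (n : ℝ) ^ 2) ^ (k + j)) := by rw [pow_add]; ring
    _ ≤ C * D := by gcongr; exact hD n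

theorem RapidDecay.summable_norm {b : ℤ → ℂ} (hb : RapidDecay b) : Summable fun n => ‖b n‖ := by
  obtain ⟨C, -, hC⟩ := hb.exists_bound 0
  refine Summable.of_nonneg_of_le (fun n => norm_nonneg _) (fun n => ?_)
    (summable_inv_one_add_sq.mul_left C)
  simpa using hC n

/-- `exp(i λ_n θ)`. -/
def kCharacter (ε : ℤˣ) (n : ℤ) (θ : ℝ) : ℂ :=
  Complex.exp ((kExponent ε n * θ : ℝ) * Complex.I)

theorem norm_kCharacter (ε : ℤˣ) (n : ℤ) (θ : ℝ) : ‖kCharacter ε n θ‖ = 1 :=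
  Complex.norm_exp_ofReal_mul_I _

theorem kCharacter_add (ε : ℤˣ) (n : ℤ) (θ φ : ℝ) :
    kCharacter ε n (θ + φ) = kCharacter ε n θ * kCharacter ε n φ := by
  rw [kCharacter, kCharacter, kCharacter, ← Complex.exp_add]
  congr 1; push_cast; ring

theorem iteratedDeriv_kCharacter (ε : ℤˣ) (n : ℤ) (k : ℕ) : iteratedDeriv k (kCharacter ε n) =
    fun θ => (kExponent ε n * Complex.I) ^ k * kCharacter ε n θ := by
  induction k with
  | zero => ext; simp
  | succ k ih =>
    rw [iteratedDeriv_succ, ih]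
    ext θ
    have h : HasDerivAt (kCharacter ε n) (kCharacter ε n θ * ((kExponent ε n * 1 : ℝ) * Complex.I)) θ :=
      ((((hasDerivAt_id θ).const_mul (kExponent ε n)).ofReal_comp).mul_const Complex.I).cexp
    rw [(h.const_mul _).deriv]
    push_cast
    ring

theorem contDiff_kCharacter (ε : ℤˣ) (n : ℤ) : ContDiff ℝ ∞ (kCharacter ε n) := by
  refine ContDiff.cexp (ContDiff.mul ?_ contDiff_const)
  exact Complex.ofRealCLM.contDiff.comp (contDiff_const.mul contDiff_id)

/-- The `k`-th derivative multiplies the `n`-th term by `(iλ_n)^k`, of size at most `8^k (1 +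
n²)^k`, so every derived series has a summable majorant. -/
theorem RapidDecay.contDiff_tsum {b : ℤ → ℂ} (hb : RapidDecay b) (ε : ℤˣ) :
    ContDiff ℝ ∞ fun θ => ∑' n, b n * kCharacter ε n θ := by
  choose C _ hC using fun k => hb.exists_bound k
  refine _root_.contDiff_tsum (N := ⊤)
    (v := fun k (n : ℤ) => 8 ^ k * (C k * (1 + (n : ℝ) ^ 2)⁻¹)) (fun n => contDiff_const.mul
      (contDiff_kCharacter ε n)) (fun k _ => (summable_inv_one_add_sq.mul_left _).mul_left _) ?_
  intro k n θ _
  rw [norm_iteratedFDeriv_eq_norm_iteratedDeriv]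
  have : iteratedDeriv k (fun θ => b n * kCharacter ε n θ) θ =
      b n * iteratedDeriv k (kCharacter ε n) θ := by
    rw [iteratedDeriv_const_mul_field]
  rw [this, iteratedDeriv_kCharacter, norm_mul, norm_mul, norm_kCharacter, mul_one, norm_pow, norm_mul,
    Complex.norm_I, mul_one, Complex.norm_real, Real.norm_eq_abs]
  have h1 : |kExponent ε n| ≤ 1 + kExponent ε n ^ 2 := by
    rw [← sq_abs]; nlinarith [sq_nonneg (|kExponent ε n| - 1)]
  have h2 : |kExponent ε n| ^ k ≤ (8 * (1 + (n : ℝ) ^ 2)) ^ k :=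
    pow_le_pow_left₀ (abs_nonneg _) (h1.trans (kExponent_sq_le ε n)) k
  calc ‖b n‖ * |kExponent ε n| ^ k ≤ ‖b n‖ * (8 * (1 + (n : ℝ) ^ 2)) ^ k := by gcongr
    _ = 8 ^ k * (‖b n‖ * (1 + (n : ℝ) ^ 2) ^ k) := by rw [mul_pow]; ring
    _ ≤ _ := mul_le_mul_of_nonneg_left (hC k n) (by positivity)

/-! ### Fourier series of smooth quasi-periodic functions -/

theorem norm_fourierCoeffOn_pi_le {p : ℝ → ℂ} {M : ℝ} (hM : ∀ x ∈ Icc 0 Real.pi, ‖p x‖ ≤ M) (n : ℤ) :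
    ‖fourierCoeffOn Real.pi_pos p n‖ ≤ M := by
  have hpi := Real.pi_pos
  rw [fourierCoeffOn_eq_integral, norm_smul, sub_zero, Real.norm_of_nonneg (by positivity)]
  have h := intervalIntegral.norm_integral_le_of_norm_le_const (a := 0) (b := Real.pi) (C := M)
    (f := fun x => fourier (-n) (x : AddCircle (Real.pi - 0)) • p x) (fun x hx => by
      rw [uIoc_of_le hpi.le] at hx
      rw [norm_smul, fourier_apply, Circle.norm_coe, one_mul]
      exact hM x ⟨hx.1.le, hx.2⟩)
  rw [sub_zero, abs_of_pos hpi] at h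
  rw [one_div, inv_mul_le_iff₀ hpi, mul_comm]
  exact h

theorem fourierCoeffOn_pi_deriv {p : ℝ → ℂ} (hp : ContDiff ℝ ∞ p)
    (hper : Function.Periodic p Real.pi) {n : ℤ} (hn : n ≠ 0) :
    fourierCoeffOn Real.pi_pos p n =
      (2 * Complex.I * n)⁻¹ * fourierCoeffOn Real.pi_pos (deriv p) n := by
  have hd := contDiff_infty_iff_deriv.1 hp
  rw [fourierCoeffOn_of_hasDerivAt Real.pi_pos hn (fun x _ => (hd.1 x).hasDerivAt)
    (hd.2.continuous.intervalIntegrable _ _)]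
  have h0 := hper 0
  rw [zero_add] at h0
  have hpi : (Real.pi : ℂ) ≠ 0 := by exact_mod_cast Real.pi_pos.ne'
  have hn' : (n : ℂ) ≠ 0 := by exact_mod_cast hn
  rw [h0, sub_self, mul_zero, zero_sub, Complex.ofReal_zero, sub_zero]
  field_simp

/-- Two integrations by parts, without boundary terms by periodicity, gain `1/(4n²)`, which absorbs
one factor `1 + n²`. The coefficient at `n = 0` is put into the constant. -/
theorem rapidDecay_fourierCoeffOn_pi {p : ℝ → ℂ} (hp : ContDiff ℝ ∞ p)
    (hper : Function.Periodic p Real.pi) : RapidDecay (fourierCoeffOn Real.pi_pos p) := by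
  intro k
  induction k generalizing p with
  | zero =>
    obtain ⟨M, hM⟩ := isCompact_Icc.exists_bound_of_continuousOn (s := Icc 0 Real.pi)
      hp.continuous.continuousOn
    exact ⟨M, fun n => by simpa using norm_fourierCoeffOn_pi_le hM n⟩
  | succ k ih =>
    have hper' : ∀ {q : ℝ → ℂ}, Function.Periodic q Real.pi →
        Function.Periodic (deriv q) Real.pi := by
      intro q hq x
      rw [← deriv_comp_add_const]
      congr 1
      exact funext hq
    have h1 := (contDiff_infty_iff_deriv.1 hp).2
    have h2 := (contDiff_infty_iff_deriv.1 h1).2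
    obtain ⟨C, hC⟩ := ih h2 (hper' (hper' hper))
    refine ⟨max C ‖fourierCoeffOn Real.pi_pos p 0‖, fun n => ?_⟩
    by_cases hn : n = 0
    · subst hn; simp
    · refine le_trans ?_ ((hC n).trans (le_max_left _ _))
      rw [fourierCoeffOn_pi_deriv hp hper hn, fourierCoeffOn_pi_deriv h1 (hper' hper) hn, norm_mul,
        norm_mul, pow_succ]
      have hn1 : (1 : ℝ) ≤ (n : ℝ) ^ 2 := by
        have : (1 : ℤ) ≤ n ^ 2 := by
          have := sq_pos_of_ne_zero hn
          omega
        exact_mod_cast this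
      have e : ‖(2 * Complex.I * (n : ℂ))⁻¹‖ * ‖(2 * Complex.I * (n : ℂ))⁻¹‖ =
          (4 * (n : ℝ) ^ 2)⁻¹ := by
        rw [← norm_mul, ← mul_inv, norm_inv]
        congr 1
        have : 2 * Complex.I * (n : ℂ) * (2 * Complex.I * n) = ((-(4 * (n : ℝ) ^ 2) : ℝ) : ℂ) := by
          push_cast
          linear_combination (4 * (n : ℂ) ^ 2) * Complex.I_sq
        rw [this, Complex.norm_real, norm_neg, Real.norm_of_nonneg (by positivity)]
      set X := ‖fourierCoeffOn Real.pi_pos (deriv (deriv p)) n‖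
      calc _ = (X * (1 + (n : ℝ) ^ 2) ^ k) * ((‖(2 * Complex.I * (n : ℂ))⁻¹‖ *
            ‖(2 * Complex.I * (n : ℂ))⁻¹‖) * (1 + (n : ℝ) ^ 2)) := by ring
        _ ≤ (X * (1 + (n : ℝ) ^ 2) ^ k) * 1 := by
            refine mul_le_mul_of_nonneg_left ?_ (by positivity)
            rw [e, inv_mul_le_iff₀ (by positivity)]
            linarith
        _ = _ := mul_one _

theorem hasSum_fourierCoeffOn_pi {p : ℝ → ℂ} (hp : ContDiff ℝ ∞ p)
    (hper : Function.Periodic p Real.pi) (θ : ℝ) :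
    HasSum (fun n : ℤ => fourierCoeffOn Real.pi_pos p n * Complex.exp ((2 * n * θ : ℝ) * Complex.I))
      (p θ) := by
  have : Fact (0 < Real.pi) := ⟨Real.pi_pos⟩
  have hpi : (Real.pi : ℂ) ≠ 0 := by exact_mod_cast Real.pi_pos.ne'
  have hcont : Continuous (hper.lift : AddCircle Real.pi → ℂ) :=
    continuous_coinduced_dom.mpr hp.continuous
  let P : C(AddCircle Real.pi, ℂ) := ⟨hper.lift, hcont⟩
  have hc : ∀ n, fourierCoeff P n = fourierCoeffOn Real.pi_pos p n := by
    intro n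
    rw [fourierCoeff_eq_intervalIntegral _ _ 0, fourierCoeffOn_eq_integral, zero_add, sub_zero]
    congr 1
  have hs : Summable (fourierCoeff P) := by
    rw [funext hc]
    exact (rapidDecay_fourierCoeffOn_pi hp hper).summable_norm.of_norm
  have := has_pointwise_sum_fourier_series_of_summable hs (θ : AddCircle Real.pi)
  have e : (fun n : ℤ => fourierCoeffOn Real.pi_pos p n *
      Complex.exp ((2 * n * θ : ℝ) * Complex.I)) =
      fun n => fourierCoeff P n • fourier n (θ : AddCircle Real.pi) := by
    ext n
    rw [hc, fourier_coe_apply, smul_eq_mul]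
    congr 2
    push_cast
    field_simp
  rw [e]
  exact this

/-- The factor `e^{iεθ/2}` gains `εi` over `π` and so makes `h` periodic with period `π`; removing
it from the ordinary Fourier series shifts the exponents `2n` to `λ_n`. -/
theorem exists_rapidDecay_hasSum (ε : ℤˣ) {h : ℝ → ℂ} (hh : ContDiff ℝ ∞ h)
    (hq : ∀ θ, h (θ + Real.pi) = -(((ε : ℤ) : ℂ) * Complex.I) * h θ) :
    ∃ b : ℤ → ℂ, RapidDecay b ∧ ∀ θ, HasSum (fun n => b n * kCharacter ε n θ) (h θ) := by
  set p : ℝ → ℂ := fun θ => h θ * Complex.exp ((((ε : ℤ) : ℝ) / 2 * θ : ℝ) * Complex.I) with hpdef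
  have hp : ContDiff ℝ ∞ p := by
    refine hh.mul (ContDiff.cexp (ContDiff.mul ?_ contDiff_const))
    exact Complex.ofRealCLM.contDiff.comp (contDiff_const.mul contDiff_id)
  have hper : Function.Periodic p Real.pi := by
    intro θ
    have e : Complex.exp ((((ε : ℤ) : ℝ) / 2 * Real.pi : ℝ) * Complex.I) =
        ((ε : ℤ) : ℂ) * Complex.I := by
      rcases Int.units_eq_one_or ε with rfl | rfl
      · rw [show ((((1 : ℤˣ) : ℤ) : ℝ) / 2 * Real.pi : ℝ) * Complex.I = Real.pi / 2 * Complex.I by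
          push_cast; ring, Complex.exp_pi_div_two_mul_I]
        simp
      · rw [show ((((-1 : ℤˣ) : ℤ) : ℝ) / 2 * Real.pi : ℝ) * Complex.I =
          -(Real.pi / 2 * Complex.I) by push_cast; ring, Complex.exp_neg,
          Complex.exp_pi_div_two_mul_I]
        simp
    simp only [hpdef]
    rw [hq, mul_add, Complex.ofReal_add, add_mul, Complex.exp_add, e]
    linear_combination (-(h θ * Complex.exp ((((ε : ℤ) : ℝ) / 2 * θ : ℝ) * Complex.I))) *
      units_mul_I_sq ε
  refine ⟨_, rapidDecay_fourierCoeffOn_pi hp hper, fun θ => ?_⟩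
  have h1 := (hasSum_fourierCoeffOn_pi hp hper θ).mul_right
    (Complex.exp (-((((ε : ℤ) : ℝ) / 2 * θ : ℝ) * Complex.I)))
  have e : p θ * Complex.exp (-((((ε : ℤ) : ℝ) / 2 * θ : ℝ) * Complex.I)) = h θ := by
    simp only [hpdef]
    rw [mul_assoc, ← Complex.exp_add, add_neg_cancel, Complex.exp_zero, mul_one]
  rw [e] at h1
  have e' : ∀ n : ℤ, fourierCoeffOn Real.pi_pos p n * kCharacter ε n θ =
      fourierCoeffOn Real.pi_pos p n * Complex.exp ((2 * n * θ : ℝ) * Complex.I) *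
        Complex.exp (-((((ε : ℤ) : ℝ) / 2 * θ : ℝ) * Complex.I)) := by
    intro n
    rw [mul_assoc, ← Complex.exp_add, kCharacter, kExponent]
    congr 2
    push_cast; ring
  simp_rw [e']
  exact h1

/-! ### Meromorphic continuation of the intertwining integrals -/

/-- This is the identity theorem on the connected plane. It gives equality off a discrete set, and
the normal form extends it to every point, poles included, so the choice made in `intertwining` is
harmless. -/
theorem eq_of_meromorphicNFOn {F G : ℂ → ℂ} (hF : MeromorphicNFOn F univ)
    (hG : MeromorphicNFOn G univ) (h : ∀ μ : ℂ, 0 < μ.re → F μ = G μ) : F = G := by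
  have hsub : MeromorphicOn (F - G) univ := hF.meromorphicOn.sub hG.meromorphicOn
  have h1 : meromorphicOrderAt (F - G) 1 = ⊤ := by
    rw [meromorphicOrderAt_eq_top_iff]
    have : ∀ᶠ z in 𝓝 (1 : ℂ), 0 < z.re :=
      (isOpen_lt continuous_const Complex.continuous_re).mem_nhds (by simp)
    filter_upwards [nhdsWithin_le_nhds this] with z hz
    simp [h z hz]
  ext z
  have hz : meromorphicOrderAt (F - G) z = ⊤ := by
    by_contra hne
    exact hsub.meromorphicOrderAt_ne_top_of_isPreconnected isPreconnected_univ (mem_univ z)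
      (mem_univ 1) hne h1
  rw [meromorphicOrderAt_eq_top_iff] at hz
  have hz' : F =ᶠ[𝓝[≠] z] G := by
    filter_upwards [hz] with w hw
    exact sub_eq_zero.1 hw
  exact (((hF (mem_univ z)).eventuallyEq_nhdsNE_iff_eventuallyEq_nhds (hG (mem_univ z))).1
    hz').eq_of_nhds

theorem IsIntertwiningContinuation.eq {ν : ℂ} {f : Mp → ℂ} {g : Mp} {F G : ℂ → ℂ}
    (hF : IsIntertwiningContinuation ν f g F) (hG : IsIntertwiningContinuation ν f g G) : F = G :=
  eq_of_meromorphicNFOn hF.1 hG.1 fun μ hμ => by rw [(hF.2 μ hμ).2, (hG.2 μ hμ).2]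

theorem intertwining_eq {ν : ℂ} {f : Mp → ℂ} {g : Mp} {F : ℂ → ℂ}
    (hF : IsIntertwiningContinuation ν f g F) : intertwining ν f g = F ν := by
  have h : ∃ F : ℂ → ℂ, IsIntertwiningContinuation ν f g F := ⟨F, hF⟩
  rw [intertwining, dif_pos h, h.choose_spec.eq hF]

theorem analyticAt_Gamma {μ : ℂ} (hμ : ∀ n : ℕ, μ ≠ -(n : ℂ)) : AnalyticAt ℂ Complex.Gamma μ := by
  have h := (Complex.differentiable_one_div_Gamma.analyticAt μ).inv
    (inv_ne_zero (Complex.Gamma_ne_zero hμ))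
  have e : (fun s : ℂ => (Complex.Gamma s)⁻¹)⁻¹ = Complex.Gamma := by ext; simp
  rwa [e] at h

theorem meromorphicAt_Gamma (μ : ℂ) : MeromorphicAt Complex.Gamma μ := by
  have h := (Complex.differentiable_one_div_Gamma.analyticAt μ).meromorphicAt.inv
  have e : (fun s : ℂ => (Complex.Gamma s)⁻¹)⁻¹ = Complex.Gamma := by ext; simp
  rwa [e] at h

/-- The Fourier series of the intertwining integral, divided by `Γ(μ)`. -/
def intertwiningSeries (ε : ℤˣ) (b : ℤ → ℂ) (θ : ℝ) (μ : ℂ) : ℂ :=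
  ∑' n, b n * kCharacter ε n (θ + Real.pi / 2) * cauchyEntire μ (kExponent ε n)

/-- On a ball the terms have polynomial growth of a fixed degree against rapidly decreasing
coefficients, so the series converges normally. -/
theorem differentiable_intertwiningSeries {ε : ℤˣ} {b : ℤ → ℂ} (hb : RapidDecay b) (θ : ℝ) :
    Differentiable ℂ (intertwiningSeries ε b θ) := by
  intro μ
  set R : ℝ := ‖μ‖ + 1 with hR
  -- Any `k` with `1 - 2k ≤ -R` puts the whole ball in the half-plane of the growth estimate.
  obtain ⟨k, hk⟩ := exists_nat_ge (R + 1)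
  obtain ⟨C, hC0, hC⟩ := exists_bound_cauchyEntire ε k R
  obtain ⟨D, hD0, hD⟩ := hb.exists_bound k
  have h := Complex.differentiableOn_tsum_of_summable_norm (U := Metric.ball 0 R)
    (F := fun n μ => b n * kCharacter ε n (θ + Real.pi / 2) * cauchyEntire μ (kExponent ε n))
    (u := fun n : ℤ => C * (D * (1 + (n : ℝ) ^ 2)⁻¹))
    ((summable_inv_one_add_sq.mul_left D).mul_left C)
    (fun n => ((differentiable_cauchyEntire _).const_mul _).differentiableOn) Metric.isOpen_ball ?_
  · exact h.differentiableAt (Metric.isOpen_ball.mem_nhds (by simp [hR]))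
  · intro n w hw
    have hw' : ‖w‖ ≤ R := by simpa using (mem_ball_zero_iff.1 hw).le
    have hre : 1 - 2 * (k : ℝ) ≤ w.re := by
      have := (abs_le.1 (Complex.abs_re_le_norm w)).1
      have : 0 ≤ ‖w‖ := norm_nonneg w
      linarith
    rw [norm_mul, norm_mul, norm_kCharacter, mul_one]
    calc ‖b n‖ * ‖cauchyEntire w (kExponent ε n)‖
        ≤ ‖b n‖ * (C * (1 + (n : ℝ) ^ 2) ^ k) := by gcongr; exact hC w hw' hre n
      _ = C * (‖b n‖ * (1 + (n : ℝ) ^ 2) ^ k) := by ring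
      _ ≤ _ := mul_le_mul_of_nonneg_left (hD n) hC0

/-- The exponent `1 + ν` from the equivariance of `f` and the exponent `μ - ν` from the transport
add up to `μ + 1`, whatever `ν` is. -/
theorem transport_kan_mul {ε : ℤˣ} {ν : ℂ} {f : Mp → ℂ} (hf : f ∈ principalSeries ε (-ν))
    (μ : ℂ) (θ u x t : ℝ) (hu : 0 < u) :
    transport ν μ f (kTilde θ * aTilde u hu * nMinusTilde x * sTilde * nTilde t) =
      (u : ℂ) ^ (-(μ + 1)) * ((cosArctan ((t - x) / u ^ 2) : ℂ) ^ (μ + 1) *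
        f (kTilde (θ + Real.pi / 2 - Real.arctan ((t - x) / u ^ 2)))) := by
  obtain ⟨z, hz⟩ := kan_mul_sTilde_mul_nTilde θ u x t hu
  rw [hz, transport, apply_kan_of_mem hf, iwasawaA_kan]
  have hc := cosArctan_pos ((t - x) / u ^ 2)
  have hu' : (u : ℂ) ≠ 0 := by exact_mod_cast hu.ne'
  have hv : 0 < cosArctan ((t - x) / u ^ 2) * u⁻¹ := by positivity
  change ((cosArctan ((t - x) / u ^ 2) * u⁻¹ : ℝ) : ℂ) ^ (1 - -ν) * _ *
    ((cosArctan ((t - x) / u ^ 2) * u⁻¹ : ℝ) : ℂ) ^ (μ - ν) = _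
  have e : ((cosArctan ((t - x) / u ^ 2) * u⁻¹ : ℝ) : ℂ) ^ (1 - -ν) *
      ((cosArctan ((t - x) / u ^ 2) * u⁻¹ : ℝ) : ℂ) ^ (μ - ν) =
      (u : ℂ) ^ (-(μ + 1)) * (cosArctan ((t - x) / u ^ 2) : ℂ) ^ (μ + 1) := by
    rw [← Complex.cpow_add _ _ (by exact_mod_cast hv.ne'),
      show 1 - -ν + (μ - ν) = μ + 1 by ring, Complex.ofReal_mul,
      Complex.mul_cpow_ofReal_nonneg hc.le (inv_pos.2 hu).le, Complex.ofReal_inv,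
      Complex.inv_cpow _ _ (by rw [Complex.arg_ofReal_of_nonneg hu.le]; exact Real.pi_pos.ne),
      Complex.cpow_neg, mul_comm]
  linear_combination (f (kTilde (θ + Real.pi / 2 - Real.arctan ((t - x) / u ^ 2)))) * e

/-- Sum and integral may be exchanged because each character has modulus 1: the `n`-th term has
`L¹`-norm `|b_n|` times a constant. The characters enter with `-λ_n`, which evenness of Cauchy's
integral removes. -/
theorem integrable_and_integral_kSeries {ε : ℤˣ} {h : ℝ → ℂ} (hh : Continuous h) {b : ℤ → ℂ}
    (hb : RapidDecay b) (hs : ∀ θ, HasSum (fun n => b n * kCharacter ε n θ) (h θ)) {μ : ℂ}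
    (hμ : 0 < μ.re) (θ : ℝ) :
    Integrable (fun y => (cosArctan y : ℂ) ^ (μ + 1) * h (θ + Real.pi / 2 - Real.arctan y)) ∧
      ∫ y, (cosArctan y : ℂ) ^ (μ + 1) * h (θ + Real.pi / 2 - Real.arctan y) =
        Complex.Gamma μ * intertwiningSeries ε b θ μ := by
  have hbd : ∀ φ, ‖h φ‖ ≤ ∑' n, ‖b n‖ := by
    intro φ
    rw [← (hs φ).tsum_eq]
    refine (norm_tsum_le_tsum_norm ?_).trans (le_of_eq ?_)
    · simpa [norm_kCharacter] using hb.summable_norm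
    · simp [norm_kCharacter]
  constructor
  · refine ((integrable_cosArctan_cpow hμ).norm.mul_const (∑' n, ‖b n‖)).mono' ?_
      (Eventually.of_forall fun y => ?_)
    · refine Continuous.aestronglyMeasurable ?_
      exact (continuous_cosArctan_cpow _).mul
        (hh.comp (continuous_const.sub Real.continuous_arctan))
    · rw [norm_mul]
      exact mul_le_mul_of_nonneg_left (hbd _) (norm_nonneg _)
  · set G : ℤ → ℝ → ℂ := fun n y => b n * kCharacter ε n (θ + Real.pi / 2) *
      cauchyIntegrand μ (-kExponent ε n) y with hG
    have hGi : ∀ n, Integrable (G n) := fun n => (integrable_cauchyIntegrand hμ _).const_mul _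
    have hGn : ∀ n, ∫ y, ‖G n y‖ = ‖b n‖ * ∫ y, cosArctan y ^ (μ.re + 1) := by
      intro n
      rw [← integral_const_mul]
      congr 1; ext y
      simp only [hG]
      rw [norm_mul, norm_mul, norm_kCharacter, mul_one, norm_cauchyIntegrand]
    have key := hasSum_integral_of_summable_integral_norm hGi (by
      simp_rw [hGn]; exact hb.summable_norm.mul_right _)
    have e1 : ∀ y, ∑' n, G n y =
        (cosArctan y : ℂ) ^ (μ + 1) * h (θ + Real.pi / 2 - Real.arctan y) := by
      intro y
      rw [← (hs _).tsum_eq, ← tsum_mul_left]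
      congr 1; ext n
      rw [sub_eq_add_neg, kCharacter_add]
      simp only [hG, cauchyIntegrand]
      rw [show kCharacter ε n (-Real.arctan y) =
        Complex.exp ((-kExponent ε n * Real.arctan y : ℝ) * Complex.I) by
          rw [kCharacter]; congr 3; ring]
      ring
    have e2 : ∀ n, ∫ y, G n y = Complex.Gamma μ *
        (b n * kCharacter ε n (θ + Real.pi / 2) * cauchyEntire μ (kExponent ε n)) := by
      intro n
      simp only [hG]
      rw [integral_const_mul]
      change _ * cauchyIntegral μ _ = _
      rw [cauchyIntegral_neg, cauchyIntegral_kExponent hμ]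
      ring
    simp_rw [e1, e2] at key
    rw [← key.tsum_eq, tsum_mul_left]
    rfl

/-- The meromorphic continuation of the intertwining integral at `k̃_θ ã_u ñ₋_x`. -/
theorem exists_isIntertwiningContinuation {ε : ℤˣ} {ν : ℂ} {f : Mp → ℂ}
    (hf : f ∈ principalSeries ε (-ν)) {b : ℤ → ℂ} (hb : RapidDecay b)
    (hs : ∀ θ, HasSum (fun n => b n * kCharacter ε n θ) (f (kTilde θ)))
    (θ u x : ℝ) (hu : 0 < u) :
    ∃ F : ℂ → ℂ, IsIntertwiningContinuation ν f (kTilde θ * aTilde u hu * nMinusTilde x) F ∧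
      ∀ μ : ℂ, (∀ n : ℕ, μ ≠ -(n : ℂ)) → AnalyticAt ℂ F μ ∧
        F μ = (u : ℂ) ^ (1 - μ) * (Complex.Gamma μ * intertwiningSeries ε b θ μ) := by
  have hu' : (u : ℂ) ≠ 0 := by exact_mod_cast hu.ne'
  set F₀ : ℂ → ℂ := fun μ => (u : ℂ) ^ (1 - μ) * (Complex.Gamma μ * intertwiningSeries ε b θ μ)
    with hF₀
  have hpow : Differentiable ℂ fun μ : ℂ => (u : ℂ) ^ (1 - μ) :=
    ((differentiable_const 1).sub differentiable_id).const_cpow (Or.inl hu')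
  have hser := differentiable_intertwiningSeries (ε := ε) hb θ
  have hmer : MeromorphicOn F₀ univ := fun μ _ =>
    (hpow.analyticAt μ).meromorphicAt.mul
      ((meromorphicAt_Gamma μ).mul (hser.analyticAt μ).meromorphicAt)
  have han : ∀ μ : ℂ, (∀ n : ℕ, μ ≠ -(n : ℂ)) → AnalyticAt ℂ F₀ μ := fun μ hμ =>
    (hpow.analyticAt μ).mul ((analyticAt_Gamma hμ).mul (hser.analyticAt μ))
  -- At nonpositive integers `Γ` has the default value 0, so `F₀` need not be in normal form there;
  -- elsewhere it is analytic and the normal form leaves it unchanged.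
  have hNF : MeromorphicNFOn (toMeromorphicNFOn F₀ univ) univ :=
    meromorphicNFOn_toMeromorphicNFOn F₀ univ
  have heq : ∀ μ : ℂ, (∀ n : ℕ, μ ≠ -(n : ℂ)) → toMeromorphicNFOn F₀ univ =ᶠ[𝓝 μ] F₀ :=
    fun μ hμ => ((hNF (mem_univ μ)).eventuallyEq_nhdsNE_iff_eventuallyEq_nhds
      (han μ hμ).meromorphicNFAt).1 (hmer.toMeromorphicNFOn_eq_self_on_nhdsNE (mem_univ μ))
  refine ⟨toMeromorphicNFOn F₀ univ, ⟨hNF, fun μ hμ => ?_⟩, fun μ hμ =>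
    ⟨(han μ hμ).congr (heq μ hμ).symm, (heq μ hμ).eq_of_nhds⟩⟩
  have hμ' : ∀ n : ℕ, μ ≠ -(n : ℂ) := by
    rintro n rfl
    have : (0 : ℝ) ≤ n := n.cast_nonneg
    simp at hμ
    linarith
  rw [(heq μ hμ').eq_of_nhds]
  simp_rw [transport_kan_mul hf μ θ u x _ hu]
  obtain ⟨hi, hint⟩ := integrable_and_integral_kSeries (contDiff_comp_kTilde hf).continuous hb hs
    hμ θ
  have hu2 : u ^ 2 ≠ 0 := by positivity
  refine ⟨((hi.comp_div hu2).comp_sub_right x).const_mul _, ?_⟩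
  rw [integral_const_mul]
  have e : ∫ t : ℝ, (cosArctan ((t - x) / u ^ 2) : ℂ) ^ (μ + 1) *
      f (kTilde (θ + Real.pi / 2 - Real.arctan ((t - x) / u ^ 2))) =
      (u ^ 2 : ℝ) * (Complex.Gamma μ * intertwiningSeries ε b θ μ) := by
    rw [integral_sub_right_eq_self (fun t : ℝ => (cosArctan (t / u ^ 2) : ℂ) ^ (μ + 1) *
      f (kTilde (θ + Real.pi / 2 - Real.arctan (t / u ^ 2)))) x,
      Measure.integral_comp_div (fun t : ℝ => (cosArctan t : ℂ) ^ (μ + 1) *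
      f (kTilde (θ + Real.pi / 2 - Real.arctan t))), hint, abs_of_nonneg (by positivity),
      Complex.real_smul]
  rw [e, ← mul_assoc]
  simp only [hF₀]
  congr 1
  -- The Jacobian `u²` of `t ↦ (t - x)/u²` turns `u^{-(μ+1)}` into `u^{1-μ}`, the factor required of
  -- an element of `V_{ε,μ}`.
  rw [show 1 - μ = -(μ + 1) + (2 : ℕ) by push_cast; ring, Complex.cpow_add _ _ hu',
    Complex.cpow_natCast]
  push_cast; rfl

/-! ### The diagonal action on Fourier coefficients -/

theorem kCharacter_pi (ε : ℤˣ) (n : ℤ) :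
    kCharacter ε n Real.pi = -(((ε : ℤ) : ℂ) * Complex.I) := by
  rcases Int.units_eq_one_or ε with rfl | rfl
  · rw [kCharacter, kExponent, show ((((2 : ℝ) * n - (((1 : ℤˣ) : ℤ) : ℝ) / 2) * Real.pi : ℝ) : ℂ) *
      Complex.I = -(Real.pi / 2 * Complex.I) + n * (2 * Real.pi * Complex.I) by push_cast; ring,
      Complex.exp_add, Complex.exp_int_mul_two_pi_mul_I, Complex.exp_neg,
      Complex.exp_pi_div_two_mul_I]
    simp
  · rw [kCharacter, kExponent, show ((((2 : ℝ) * n - (((-1 : ℤˣ) : ℤ) : ℝ) / 2) * Real.pi : ℝ) : ℂ) *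
      Complex.I = (Real.pi / 2 * Complex.I) + n * (2 * Real.pi * Complex.I) by push_cast; ring,
      Complex.exp_add, Complex.exp_int_mul_two_pi_mul_I, Complex.exp_pi_div_two_mul_I]
    simp

/-- The scalar by which the intertwining operator acts on the `n`-th `K̃`-type. -/
def intertwiningScalar (ε : ℤˣ) (ν : ℂ) (n : ℤ) : ℂ :=
  kCharacter ε n (Real.pi / 2) * (Complex.Gamma ν * cauchyEntire ν (kExponent ε n))

theorem RapidDecay.mul_intertwiningScalar {b : ℤ → ℂ} (hb : RapidDecay b) (ε : ℤˣ) (ν : ℂ) :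
    RapidDecay fun n => b n * intertwiningScalar ε ν n := by
  obtain ⟨k, hk⟩ := exists_nat_ge (1 - ν.re)
  obtain ⟨C, -, hC⟩ := exists_bound_cauchyEntire ε k ‖ν‖
  refine hb.mul (C := ‖Complex.Gamma ν‖ * C) (k := k) fun n => ?_
  have h0 : (0 : ℝ) ≤ k := k.cast_nonneg
  rw [intertwiningScalar, norm_mul, norm_mul, norm_kCharacter, one_mul, mul_assoc]
  exact mul_le_mul_of_nonneg_left (hC ν le_rfl (by linarith) n) (norm_nonneg _)

/-- `I_{ε,ν}` is defined on every `f ∈ V_{ε,-ν}^∞` if `ν` is not a nonpositive integer, and acts on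
Fourier coefficients by the scalars `intertwiningScalar`. -/
theorem intertwining_spec {ε : ℤˣ} {ν : ℂ} (hν : ∀ n : ℕ, ν ≠ -(n : ℂ)) {f : Mp → ℂ}
    (hf : f ∈ principalSeries ε (-ν)) {b : ℤ → ℂ} (hb : RapidDecay b)
    (hs : ∀ θ, HasSum (fun n => b n * kCharacter ε n θ) (f (kTilde θ))) :
    IntertwiningDefinedAt ν f ∧ intertwining ν f ∈ principalSeries ε ν ∧
      ∀ θ, HasSum (fun n => b n * intertwiningScalar ε ν n * kCharacter ε n θ)
        (intertwining ν f (kTilde θ)) := by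
  have hb' := hb.mul_intertwiningScalar ε ν
  set h : ℝ → ℂ := fun θ => ∑' n, b n * intertwiningScalar ε ν n * kCharacter ε n θ with hdef
  have hsum : ∀ θ, HasSum (fun n => b n * intertwiningScalar ε ν n * kCharacter ε n θ) (h θ) := by
    intro θ
    refine (Summable.of_norm ?_).hasSum
    simpa [norm_kCharacter] using hb'.summable_norm
  have hq : ∀ θ, h (θ + Real.pi) = -(((ε : ℤ) : ℂ) * Complex.I) * h θ := by
    intro θ
    simp only [hdef]
    rw [← tsum_mul_left]
    congr 1; ext n
    rw [kCharacter_add, kCharacter_pi]; ring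
  have hc : -(((ε : ℤ) : ℂ) * Complex.I) * -(((ε : ℤ) : ℂ) * Complex.I) = -1 := by
    rw [neg_mul_neg, units_mul_I_sq]
  -- Since the continuation at `ν` carries the factor `u^{1-ν}`, the image is the extension of its
  -- own restriction to `K̃`; smoothness and equivariance then follow from `kExtend_mem`.
  have hval : intertwining ν f = kExtend ν h := by
    ext g
    obtain ⟨θ, u, x, hu, rfl⟩ := exists_kan g
    obtain ⟨F, hF, hF'⟩ := exists_isIntertwiningContinuation hf hb hs θ u x hu
    rw [intertwining_eq hF, (hF' ν hν).2, kExtend_kan hc hq]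
    congr 1
    rw [intertwiningSeries, ← tsum_mul_left]
    simp only [hdef]
    congr 1; ext n
    rw [kCharacter_add, intertwiningScalar]; ring
  refine ⟨?_, ?_, fun θ => ?_⟩
  · intro g
    obtain ⟨θ, u, x, hu, rfl⟩ := exists_kan g
    obtain ⟨F, hF, hF'⟩ := exists_isIntertwiningContinuation hf hb hs θ u x hu
    exact ⟨F, hF, (hF' ν hν).1⟩
  · rw [hval]
    exact kExtend_mem (hb'.contDiff_tsum ε) hq ν
  · rw [hval, kExtend_kTilde hc hq]
    exact hsum θ

/-! ### The composition of the operators at `ν` and `-ν` -/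

theorem inv_Gamma_mul_inv_Gamma (z : ℂ) :
    (Complex.Gamma z)⁻¹ * (Complex.Gamma (1 - z))⁻¹ = Complex.sin (Real.pi * z) / Real.pi := by
  rw [← mul_inv, Complex.Gamma_mul_Gamma_one_sub, inv_div]

/-- The phases multiply to `e^{iπλ} = -εi`, the factors `Γ(±ν)` to `-π/(ν sin πν)`, and the four
reciprocal gammas pair by reflection into `4 cos(π(ν+λ)/2) cos(π(ν-λ)/2) = 2(cos πν + cos πλ)`. -/
theorem intertwiningScalar_mul_neg (ε : ℤˣ) {ν : ℂ} (hν : ∀ n : ℤ, ν ≠ (n : ℂ)) (n : ℤ) :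
    intertwiningScalar ε ν n * intertwiningScalar ε (-ν) n =
      2 * Real.pi * ((ε : ℤ) : ℂ) * Complex.I * Complex.cot (Real.pi * ν) / ν := by
  have hpi : (Real.pi : ℂ) ≠ 0 := by exact_mod_cast Real.pi_pos.ne'
  have hν0 : ν ≠ 0 := by simpa using hν 0
  have hsin : Complex.sin (Real.pi * ν) ≠ 0 := by
    rw [Ne, Complex.sin_eq_zero_iff]
    rintro ⟨k, hk⟩
    exact hν k (mul_left_cancel₀ hpi (by rw [hk]; ring))
  set l : ℝ := kExponent ε n with hl
  -- `e^{iπλ} = -εi` has real part zero; this removes the only dependence on `n`.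
  have hcosl : Complex.cos (Real.pi * l) = 0 := by
    have h := kCharacter_pi ε n
    have hre := congrArg Complex.re h
    rw [kCharacter, Complex.exp_ofReal_mul_I_re] at hre
    rw [← Complex.ofReal_mul, ← Complex.ofReal_cos, mul_comm, hl, hre]
    simp
  have hk : kCharacter ε n (Real.pi / 2) * kCharacter ε n (Real.pi / 2) =
      -(((ε : ℤ) : ℂ) * Complex.I) := by
    rw [← kCharacter_add, add_halves, kCharacter_pi]
  have hG : Complex.Gamma ν * Complex.Gamma (-ν) = -(Real.pi / (ν * Complex.sin (Real.pi * ν))) := by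
    have h1 := Complex.Gamma_mul_Gamma_one_sub ν
    have h2 := Complex.Gamma_add_one (-ν) (neg_ne_zero.2 hν0)
    rw [show -ν + 1 = 1 - ν by ring] at h2
    rw [h2] at h1
    rw [eq_div_iff hsin] at h1
    rw [← neg_div, eq_div_iff (mul_ne_zero hν0 hsin)]
    linear_combination (-1 : ℂ) * h1
  have hE : cauchyEntire ν l * cauchyEntire (-ν) l = 2 * Complex.cos (Real.pi * ν) := by
    have h1 := inv_Gamma_mul_inv_Gamma ((1 + ν + l) / 2)
    have h2 := inv_Gamma_mul_inv_Gamma ((1 + ν - l) / 2)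
    rw [show 1 - (1 + ν + l) / 2 = (1 + -ν - l) / 2 by ring,
      show Real.pi * ((1 + ν + l) / 2) = Real.pi * (ν + l) / 2 + Real.pi / 2 by ring,
      Complex.sin_add_pi_div_two] at h1
    rw [show 1 - (1 + ν - l) / 2 = (1 + -ν + l) / 2 by ring,
      show Real.pi * ((1 + ν - l) / 2) = Real.pi * (ν - l) / 2 + Real.pi / 2 by ring,
      Complex.sin_add_pi_div_two] at h2
    have h3 : (2 : ℂ) ^ (1 - ν) * 2 ^ (1 - -ν) = 4 := by
      rw [← Complex.cpow_add _ _ two_ne_zero, show 1 - ν + (1 - -ν) = (2 : ℕ) by push_cast; ring,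
        Complex.cpow_natCast]
      norm_num
    have h4 : 2 * (Complex.cos (Real.pi * (ν + l) / 2) * Complex.cos (Real.pi * (ν - l) / 2)) =
        Complex.cos (Real.pi * ν) := by
      have a1 := Complex.cos_add (Real.pi * (ν + l) / 2) (Real.pi * (ν - l) / 2)
      have a2 := Complex.cos_sub (Real.pi * (ν + l) / 2) (Real.pi * (ν - l) / 2)
      rw [show Real.pi * (ν + l) / 2 + Real.pi * (ν - l) / 2 = Real.pi * ν by ring] at a1
      rw [show Real.pi * (ν + l) / 2 - Real.pi * (ν - l) / 2 = Real.pi * l by ring, hcosl] at a2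
      linear_combination (-1 : ℂ) * a1 - a2
    unfold cauchyEntire
    calc _ = (Real.pi : ℂ) ^ 2 * (2 ^ (1 - ν) * 2 ^ (1 - -ν)) *
          (((Complex.Gamma ((1 + ν + l) / 2))⁻¹ * (Complex.Gamma ((1 + -ν - l) / 2))⁻¹) *
          ((Complex.Gamma ((1 + ν - l) / 2))⁻¹ * (Complex.Gamma ((1 + -ν + l) / 2))⁻¹)) := by ring
      _ = 4 * (Complex.cos (Real.pi * (ν + l) / 2) * Complex.cos (Real.pi * (ν - l) / 2)) := by
          rw [h1, h2, h3]; field_simp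
      _ = _ := by rw [← h4]; ring
  rw [intertwiningScalar, intertwiningScalar, ← hl]
  calc _ = (kCharacter ε n (Real.pi / 2) * kCharacter ε n (Real.pi / 2)) *
        (Complex.Gamma ν * Complex.Gamma (-ν)) * (cauchyEntire ν l * cauchyEntire (-ν) l) := by ring
    _ = _ := by
        rw [hk, hG, hE, Complex.cot]
        field_simp

theorem intertwining_comp {ε : ℤˣ} {ν : ℂ} (hν : ∀ n : ℤ, ν ≠ (n : ℂ)) {f : Mp → ℂ}
    (hf : f ∈ principalSeries ε (-ν)) :
    IntertwiningDefinedAt ν f ∧ intertwining ν f ∈ principalSeries ε ν ∧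
      IntertwiningDefinedAt (-ν) (intertwining ν f) ∧
      intertwining (-ν) (intertwining ν f) =
        (2 * (Real.pi : ℂ) * ((ε : ℤ) : ℂ) * Complex.I * Complex.cot ((Real.pi : ℂ) * ν) / ν) • f := by
  obtain ⟨b, hb, hs⟩ := exists_rapidDecay_hasSum ε (contDiff_comp_kTilde hf)
    (apply_kTilde_add_pi_of_mem hf)
  have hν1 : ∀ n : ℕ, ν ≠ -(n : ℂ) := fun n => by simpa using hν (-n)
  have hν2 : ∀ n : ℕ, -ν ≠ -(n : ℂ) := fun n h => hν n (by simpa using neg_injective h)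
  obtain ⟨h1, h2, h3⟩ := intertwining_spec hν1 hf hb hs
  obtain ⟨h4, h5, h6⟩ := intertwining_spec hν2 (ε := ε) (by rwa [neg_neg])
    (hb.mul_intertwiningScalar ε ν) h3
  refine ⟨h1, h2, h4, eq_of_eqOn_kTilde h5 (Submodule.smul_mem _ _ hf) fun θ => ?_⟩
  rw [Pi.smul_apply, smul_eq_mul]
  refine (h6 θ).unique ?_
  have e : ∀ n, b n * intertwiningScalar ε ν n * intertwiningScalar ε (-ν) n * kCharacter ε n θ =
      2 * Real.pi * ((ε : ℤ) : ℂ) * Complex.I * Complex.cot (Real.pi * ν) / ν *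
        (b n * kCharacter ε n θ) := fun n => by
    rw [← intertwiningScalar_mul_neg ε hν n]; ring
  simp_rw [e]
  exact (hs θ).mul_left _

/-! ### The operator on a single `K̃`-type -/

theorem rapidDecay_single (m : ℤ) : RapidDecay (Pi.single m 1) := by
  intro k
  refine ⟨(1 + (m : ℝ) ^ 2) ^ k, fun n => ?_⟩
  by_cases h : n = m
  · subst h; simp
  · rw [Pi.single_eq_of_ne h, norm_zero, zero_mul]; positivity

/-- `φ` has one Fourier coefficient, at `n = -εℓ/2`, where `λ_n = -ε(1/2 + ℓ)`; so the operator acts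
on it by one eigenvalue, with phase `e^{iπλ_n/2} = i^{-εℓ} e^{-iεπ/4}`. -/
theorem intertwining_isKVector {ε : ℤˣ} {ν : ℂ} {ℓ : ℤ} (hℓ : Even ℓ) (hν : ∀ n : ℕ, ν ≠ -(n : ℂ))
    {φ φ' : Mp → ℂ} (hφ : IsKVector ε (-ν) ℓ φ) (hφ' : IsKVector ε ν ℓ φ') :
    IntertwiningDefinedAt ν φ ∧ intertwining ν φ =
      (Complex.I ^ (-(ε : ℤ) * ℓ) * ((1 - ((ε : ℤ) : ℂ) * Complex.I) / (Real.sqrt 2 : ℂ)) *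
        ((Real.pi : ℂ) * 2 ^ (1 - ν) * Complex.Gamma ν /
          (Complex.Gamma (-(1 / 2) * ((ℓ : ℂ) + 1 / 2) + (ν + 1) / 2) *
            Complex.Gamma ((1 / 2) * ((ℓ : ℂ) + 1 / 2) + (ν + 1) / 2)))) • φ' := by
  obtain ⟨j, hj⟩ := hℓ
  obtain ⟨m, hm⟩ : ∃ m : ℤ, m = -(ε : ℤ) * j := ⟨_, rfl⟩
  have hl : kExponent ε m = -((ε : ℤ) : ℝ) * (1 / 2 + (ℓ : ℝ)) := by
    rw [kExponent, hm, hj]; push_cast; ring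
  have hchar : ∀ θ : ℝ, Complex.exp (-((ε : ℤ) : ℂ) * (1 / 2 + (ℓ : ℂ)) * Complex.I * (θ : ℂ)) =
      kCharacter ε m θ := by
    intro θ
    rw [kCharacter, hl]
    congr 1; push_cast; ring
  have hs : ∀ θ, HasSum (fun n => (Pi.single m 1 : ℤ → ℂ) n * kCharacter ε n θ)
      (φ (kTilde θ)) := by
    intro θ
    rw [hφ.2, hchar]
    have := hasSum_single (f := fun n => (Pi.single m 1 : ℤ → ℂ) n * kCharacter ε n θ) m
      fun n hn => by simp [Pi.single_eq_of_ne hn]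
    simpa using this
  obtain ⟨h1, h2, h3⟩ := intertwining_spec hν hφ.1 (rapidDecay_single m) hs
  refine ⟨h1, eq_of_eqOn_kTilde h2 (Submodule.smul_mem _ _ hφ'.1) fun θ => ?_⟩
  have hs' : HasSum (fun n => (Pi.single m 1 : ℤ → ℂ) n * intertwiningScalar ε ν n *
      kCharacter ε n θ) (intertwiningScalar ε ν m * kCharacter ε m θ) := by
    have := hasSum_single (f := fun n => (Pi.single m 1 : ℤ → ℂ) n * intertwiningScalar ε ν n *
      kCharacter ε n θ) m fun n hn => by simp [Pi.single_eq_of_ne hn]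
    simpa using this
  rw [(h3 θ).unique hs', Pi.smul_apply, smul_eq_mul, hφ'.2, hchar]
  congr 1
  have hr2 : ((√2 : ℝ) : ℂ) * (√2 : ℝ) = 2 := by
    rw [← Complex.ofReal_mul, Real.mul_self_sqrt (by norm_num)]; norm_num
  have hr0 : ((√2 : ℝ) : ℂ) ≠ 0 := fun h => by simp [h] at hr2
  have hk : kCharacter ε m (Real.pi / 2) =
      Complex.I ^ (-(ε : ℤ) * ℓ) * ((1 - ((ε : ℤ) : ℂ) * Complex.I) / (√2 : ℂ)) := by
    have hI : Complex.I ^ (-(ε : ℤ) * ℓ) =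
        Complex.exp (((-(ε : ℤ) * ℓ : ℤ) : ℂ) * (Real.pi / 2 * Complex.I)) := by
      rw [Complex.exp_int_mul, Complex.exp_pi_div_two_mul_I]
    have h8 : Complex.exp ((-(((ε : ℤ) : ℝ) * (Real.pi / 4)) : ℝ) * Complex.I) =
        (1 - ((ε : ℤ) : ℂ) * Complex.I) / (√2 : ℂ) := by
      rw [Complex.exp_mul_I, ← Complex.ofReal_cos, ← Complex.ofReal_sin, Real.cos_neg, Real.sin_neg,
        eq_div_iff hr0]
      rcases Int.units_eq_one_or ε with rfl | rfl
      · simp only [Units.val_one, Int.cast_one, one_mul, Real.cos_pi_div_four, Real.sin_pi_div_four]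
        push_cast
        linear_combination ((1 - Complex.I) / 2) * hr2
      · simp only [Units.val_neg, Units.val_one, Int.cast_neg, Int.cast_one, neg_mul, one_mul,
          Real.cos_neg, Real.sin_neg, Real.cos_pi_div_four, Real.sin_pi_div_four]
        push_cast
        linear_combination ((1 + Complex.I) / 2) * hr2
    rw [hI, ← h8, ← Complex.exp_add, kCharacter, hl]
    congr 1; push_cast; ring
  -- Evenness in `λ` removes the sign `-ε` from the gamma factors.
  have hE : cauchyEntire ν (kExponent ε m) = cauchyEntire ν (1 / 2 + ℓ) := by
    rw [hl]
    rcases Int.units_eq_one_or ε with rfl | rfl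
    · rw [← cauchyEntire_neg]; congr 1; simp
    · congr 1; simp
  rw [intertwiningScalar, hk, hE, cauchyEntire]
  congr 1
  rw [show (1 + ν + ((1 / 2 + ℓ : ℝ) : ℂ)) / 2 = (1 / 2) * ((ℓ : ℂ) + 1 / 2) + (ν + 1) / 2 by
      push_cast; ring,
    show (1 + ν - ((1 / 2 + ℓ : ℝ) : ℂ)) / 2 = -(1 / 2) * ((ℓ : ℂ) + 1 / 2) + (ν + 1) / 2 by
      push_cast; ring, mul_comm (Complex.Gamma _)⁻¹, ← mul_inv,
    div_eq_mul_inv (Real.pi * 2 ^ (1 - ν) * Complex.Gamma ν : ℂ)]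
  ring

end Metaplectic

end

theorem mainTheorem8 (ε : ℤˣ) :
    -- existence and uniqueness of `φ_{ε,ν,ℓ}`
    (∀ (ν : ℂ) (ℓ : ℤ), Even ℓ → ∃! φ : Metaplectic.Mp → ℂ, Metaplectic.IsKVector ε ν ℓ φ) ∧
    -- the action of `I_{ε,ν}` on `φ_{ε,-ν,ℓ}`
    (∀ (ν : ℂ) (ℓ : ℤ), Even ℓ → (∀ n : ℕ, ν ≠ -(n : ℂ)) →
      ∀ φ φ' : Metaplectic.Mp → ℂ,
        Metaplectic.IsKVector ε (-ν) ℓ φ → Metaplectic.IsKVector ε ν ℓ φ' →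
          Metaplectic.IntertwiningDefinedAt ν φ ∧
          Metaplectic.intertwining ν φ =
            (Complex.I ^ (-(ε : ℤ) * ℓ) * ((1 - ((ε : ℤ) : ℂ) * Complex.I) / (Real.sqrt 2 : ℂ)) *
              ((Real.pi : ℂ) * 2 ^ (1 - ν) * Complex.Gamma ν /
                (Complex.Gamma (-(1 / 2) * ((ℓ : ℂ) + 1 / 2) + (ν + 1) / 2) *
                  Complex.Gamma ((1 / 2) * ((ℓ : ℂ) + 1 / 2) + (ν + 1) / 2)))) • φ') ∧
    -- the composition `I_{ε,-ν} I_{ε,ν}`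
    (∀ ν : ℂ, (∀ n : ℤ, ν ≠ (n : ℂ)) → ∀ f ∈ Metaplectic.principalSeries ε (-ν),
      Metaplectic.IntertwiningDefinedAt ν f ∧
      Metaplectic.intertwining ν f ∈ Metaplectic.principalSeries ε ν ∧
      Metaplectic.IntertwiningDefinedAt (-ν) (Metaplectic.intertwining ν f) ∧
      Metaplectic.intertwining (-ν) (Metaplectic.intertwining ν f) =
        (2 * (Real.pi : ℂ) * ((ε : ℤ) : ℂ) * Complex.I * Complex.cot ((Real.pi : ℂ) * ν) / ν) • f) :=
  ⟨fun ν ℓ hℓ => Metaplectic.existsUnique_isKVector ε ν ℓ hℓ,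
    fun _ _ hℓ hν _ _ hφ hφ' => Metaplectic.intertwining_isKVector hℓ hν hφ hφ',
    fun _ hν _ hf => Metaplectic.intertwining_comp hν hf⟩
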